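/- Let $n>2$, let $\mathbb R^{n,+}=\{x\in\mathbb R^n: x_n>0\}$, and let $Cl_n$ be the real Clifford algebra generated by the standard basis $e_1,\dots,e_n$ of $\mathbb R^n$ with $e_ie_j+e_je_i=-2\delta_{ij}$. Let $Cl_{n-1}\subset Cl_n$ be the subalgebra generated by $e_1,\dots,e_{n-1}$. Every $A\in Cl_n$ is uniquely $A=B+Ce_n$ with $B,C\in Cl_{n-1}$; put $P(A)=B$, $Q(A)=C$, $Q'(A)=-e_nQ(A)e_n$. Let $D=\sum_{j=1}^n e_j\,\partial/\partial x_j$, let $Mf=Df+\frac{n-2}{x_n}Q'(f)$ be the Dirac-Hodge operator, and let $\triangle_{R^{n,+}}=\triangle-\frac{n-2}{x_n}\frac{\partial}{\partial x_n}$ be the hyperbolic Laplacian, where $\triangle$ is the Euclidean Laplacian. A subscript $y$ on an operator means that it acts in the variable $y$. For $y\in\mathbb R^{n,+}$ let $\hat y=(y_1,\dots,y_{n-1},-y_n)$, and for $x\ne y$ in $\mathbb R^{n,+}$ let $$G(x,y)=\int_{\|x-y\|/\|x-\hat y\|}^{1}\frac{(1-t^2)^{n-2}}{t^{n-1}}\,dt,\qquad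 h(x,y)=D_yG(x,y).$$ Let $\omega_n$ be the surface area of the unit sphere in $\mathbb R^n$. Suppose that $\psi$ is a $Cl_{n-1}$-valued $C^\infty$ function with compact support in $\mathbb R^{n,+}$. Then for every $y\in\mathbb R^{n,+}$ the integrals $$\int_{\mathbb R^{n,+}}G(x,y)\psi(x)\frac{dx}{x_n^{n-2}},\qquad \int_{\mathbb R^{n,+}}h(x,y)\psi(x)\frac{dx}{x_n^{n-2}}$$ converge absolutely and define, respectively, a $C^2$ and a $C^1$ function of $y\in\mathbb R^{n,+}$, and $$\triangle_{R^{n,+},y}\left(-\frac{1}{2^{n-2}\omega_n}\int_{\mathbb R^{n,+}}G(x,y)\psi(x)\frac{dx}{x_n^{n-2}}\right)=\psi(y),$$ so that the normalized hyperbolic Green potential is a right inverse of $\triangle_{R^{n,+}}$; likewise $$P\left(M_y\left(\frac{1}{2^{n-2}\omega_n}\int_{\mathbb R^{n,+}}h(x,y)\psi(x)\frac{dx}{x_n^{n-2}}\right)\right)=\psi(y).$$ -/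

import Mathlib

open MeasureTheory Set
open scoped ContDiff RealInnerProductSpace

noncomputable section

namespace UpperHalfSpace

/-- Euclidean space `ℝⁿ`. -/
abbrev E (n : ℕ) : Type := EuclideanSpace ℝ (Fin n)

/-- The index of the last coordinate `x_n`. -/
def last (n : ℕ) [NeZero n] : Fin n := ⟨n - 1, Nat.sub_lt (NeZero.pos n) one_pos⟩

/-- The standard basis vector `e_j` of `ℝⁿ`. -/
def stdVec {n : ℕ} (j : Fin n) : E n := EuclideanSpace.single j (1 : ℝ)

/-- Upper half space `{x ∈ ℝⁿ : x_n > 0}`. -/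
def halfSpace (n : ℕ) [NeZero n] : Set (E n) := {x | 0 < x (last n)}

/-! ### The Clifford algebra of `ℝⁿ` with negative definite inner product -/

/-- The quadratic form `x ↦ -‖x‖²` on `ℝⁿ`. -/
def negSq (n : ℕ) : QuadraticForm ℝ (E n) :=
  -(LinearMap.BilinMap.toQuadraticMap (innerₗ (E n)))

theorem negSq_apply {n : ℕ} (x : E n) : negSq n x = -‖x‖ ^ 2 := by
  simp [negSq, LinearMap.BilinMap.toQuadraticMap_apply]

/-- The Clifford algebra `Cl_n`, in which `x * x = -‖x‖²` for vectors `x`. -/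
abbrev Cl (n : ℕ) : Type := CliffordAlgebra (negSq n)

/-- The generator `e_j` of `Cl_n`. -/
def e {n : ℕ} (j : Fin n) : Cl n := CliffordAlgebra.ι (negSq n) (stdVec j)

/-- The coordinates of an element of `Cl_n` with respect to the basis `e_A`, `A ⊆ {1, …, n}`;
for an orthogonal family, products in `Cl_n` correspond to wedge products in `Λ(ℝⁿ)`. -/
def coords (n : ℕ) : Cl n ≃ₗ[ℝ] EuclideanSpace ℝ (Finset (Fin n)) :=
  (CliffordAlgebra.equivExterior (negSq n)).trans
    (((EuclideanSpace.basisFun (Fin n) ℝ).toBasis.ExteriorAlgebra.equivFun).trans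
      (WithLp.linearEquiv 2 ℝ (Finset (Fin n) → ℝ)).symm)

/-- The norm `‖A‖ = (∑ a_A²)^{1/2}` on `Cl_n`. -/
instance instNormedAddCommGroupCl (n : ℕ) : NormedAddCommGroup (Cl n) :=
  NormedAddCommGroup.induced (Cl n) (EuclideanSpace ℝ (Finset (Fin n)))
    (coords n).toLinearMap (coords n).injective

instance instNormedSpaceCl (n : ℕ) : NormedSpace ℝ (Cl n) :=
  NormedSpace.induced ℝ (Cl n) (EuclideanSpace ℝ (Finset (Fin n))) (coords n).toLinearMap

instance instFiniteDimensionalCl (n : ℕ) : FiniteDimensional ℝ (Cl n) :=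
  Module.Finite.equiv (coords n).symm

/-- `Cl_{n-1}`, the subalgebra of `Cl_n` generated by `e_1, …, e_{n-1}`. -/
def ClSub (n : ℕ) [NeZero n] : Subalgebra ℝ (Cl n) :=
  Algebra.adjoin ℝ {a | ∃ j : Fin n, j ≠ last n ∧ a = e j}

/-- The reflection `x ↦ x̂` of `ℝⁿ` which changes the sign of the last coordinate. -/
def reflect (n : ℕ) [NeZero n] : E n ≃ₗᵢ[ℝ] E n := (ℝ ∙ stdVec (last n))ᗮ.reflection

theorem reflect_eq {n : ℕ} [NeZero n] (x : E n) :
    reflect n x = x - (2 * x (last n)) • stdVec (last n) := by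
  rw [reflect, Submodule.reflection_orthogonal_apply, Submodule.reflection_singleton_apply]
  simp [stdVec, EuclideanSpace.inner_single_left]
  module

/-- The algebra automorphism of `Cl_n` with `e_n ↦ -e_n` and `e_j ↦ e_j` for `j < n`. -/
def hat (n : ℕ) [NeZero n] : Cl n →ₐ[ℝ] Cl n :=
  CliffordAlgebra.map
    { toLinearMap := (reflect n).toLinearEquiv.toLinearMap
      map_app' := fun x => by
        change negSq n (reflect n x) = negSq n x
        rw [negSq_apply, negSq_apply, LinearIsometryEquiv.norm_map] }

/-- The `Cl_{n-1}`-part `P(A) = B` of `A = B + C e_n` with `B, C ∈ Cl_{n-1}`. -/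
def P {n : ℕ} [NeZero n] (A : Cl n) : Cl n := (1 / 2 : ℝ) • (A + hat n A)

/-- The part `Q(A) = C` of `A = B + C e_n` with `B, C ∈ Cl_{n-1}`. -/
def Q {n : ℕ} [NeZero n] (A : Cl n) : Cl n := (1 / 2 : ℝ) • ((hat n A - A) * e (last n))

theorem e_sq {n : ℕ} (j : Fin n) : e j * e j = (-1 : Cl n) := by
  rw [e, CliffordAlgebra.ι_sq_scalar, negSq_apply]
  simp [stdVec]

theorem e_anticomm {n : ℕ} {i j : Fin n} (h : i ≠ j) : (e i * e j : Cl n) = -(e j * e i) := by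
  rw [e, e, CliffordAlgebra.ι_mul_ι_comm, QuadraticMap.polar, negSq_apply, negSq_apply,
    negSq_apply, norm_add_sq_real]
  simp [stdVec, EuclideanSpace.inner_single_left, h]

theorem hat_e_last {n : ℕ} [NeZero n] : hat n (e (last n)) = -e (last n) := by
  rw [hat, e, CliffordAlgebra.map_apply_ι, ← map_neg]
  congr 1
  change reflect n _ = _
  rw [reflect_eq]
  simp [stdVec]
  module

theorem hat_e_of_ne {n : ℕ} [NeZero n] {j : Fin n} (h : j ≠ last n) : hat n (e j) = e j := by
  rw [hat, e, CliffordAlgebra.map_apply_ι]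
  congr 1
  change reflect n _ = _
  rw [reflect_eq]
  simp [stdVec, h.symm]

theorem hat_of_mem {n : ℕ} [NeZero n] {B : Cl n} (hB : B ∈ ClSub n) : hat n B = B := by
  induction hB using Algebra.adjoin_induction with
  | mem x hx => obtain ⟨j, hj, rfl⟩ := hx; exact hat_e_of_ne hj
  | algebraMap r => exact AlgHom.commutes _ r
  | add x y _ _ hx hy => rw [map_add, hx, hy]
  | mul x y _ _ hx hy => rw [map_mul, hx, hy]

/-- If `A = B + C e_n` with `B, C ∈ Cl_{n-1}` then `P(A) = B` and `Q(A) = C`. -/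
theorem P_Q_unique {n : ℕ} [NeZero n] {B C : Cl n} (hB : B ∈ ClSub n) (hC : C ∈ ClSub n) :
    P (B + C * e (last n)) = B ∧ Q (B + C * e (last n)) = C := by
  have h : hat n (B + C * e (last n)) = B - C * e (last n) := by
    rw [map_add, map_mul, hat_of_mem hB, hat_of_mem hC, hat_e_last]; simp [sub_eq_add_neg]
  constructor
  · rw [P, h]; module
  · have h2 : (B - C * e (last n) - (B + C * e (last n))) * e (last n) = (2 : ℝ) • C := by
      have : (B - C * e (last n) - (B + C * e (last n))) * e (last n)
          = -((2 : ℝ) • (C * (e (last n) * e (last n)))) := by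
        rw [two_smul]; noncomm_ring
      rw [this, e_sq]; simp
    rw [Q, h, h2]; module

theorem e_last_mul_mem {n : ℕ} [NeZero n] {B : Cl n} (hB : B ∈ ClSub n) :
    ∃ B' ∈ ClSub n, e (last n) * B = B' * e (last n) := by
  induction hB using Algebra.adjoin_induction with
  | mem x hx =>
    obtain ⟨j, hj, rfl⟩ := hx
    have hm : (e j : Cl n) ∈ ClSub n := Algebra.subset_adjoin ⟨j, hj, rfl⟩
    exact ⟨-e j, neg_mem hm, by rw [e_anticomm hj.symm, neg_mul]⟩
  | algebraMap r => exact ⟨_, Subalgebra.algebraMap_mem _ r, (Algebra.commutes r _).symm⟩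
  | add x y _ _ hx hy =>
    obtain ⟨x', hx', h1⟩ := hx
    obtain ⟨y', hy', h2⟩ := hy
    exact ⟨x' + y', add_mem hx' hy', by rw [mul_add, h1, h2, add_mul]⟩
  | mul x y _ _ hx hy =>
    obtain ⟨x', hx', h1⟩ := hx
    obtain ⟨y', hy', h2⟩ := hy
    exact ⟨x' * y', mul_mem hx' hy', by rw [← mul_assoc, h1, mul_assoc, h2, mul_assoc]⟩

/-- Every `A ∈ Cl_n` is of the form `B + C e_n` with `B, C ∈ Cl_{n-1}`. -/
theorem exists_decomp {n : ℕ} [NeZero n] (A : Cl n) :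
    ∃ B ∈ ClSub n, ∃ C ∈ ClSub n, A = B + C * e (last n) := by
  have hgen : ∀ x : E n, ∃ B ∈ ClSub n, ∃ c : ℝ,
      CliffordAlgebra.ι (negSq n) x = B + c • e (last n) := by
    intro x
    have hm : ∀ j ∈ Finset.univ.erase (last n), (x j • e j : Cl n) ∈ ClSub n := fun j hj =>
      Subalgebra.smul_mem _ (Algebra.subset_adjoin (s := {a | ∃ j : Fin n, j ≠ last n ∧ a = e j})
        ⟨j, (Finset.mem_erase.1 hj).1, rfl⟩) _
    refine ⟨∑ j ∈ Finset.univ.erase (last n), x j • e j, sum_mem hm, x (last n), ?_⟩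
    rw [Finset.sum_erase_add _ _ (Finset.mem_univ _)]
    conv_lhs => rw [← (EuclideanSpace.basisFun (Fin n) ℝ).sum_repr x, map_sum]
    simp [e, stdVec]
  induction A using CliffordAlgebra.left_induction with
  | algebraMap r => exact ⟨_, Subalgebra.algebraMap_mem _ r, 0, zero_mem _, by simp⟩
  | add x y hx hy =>
    obtain ⟨B, hB, C, hC, rfl⟩ := hx
    obtain ⟨B', hB', C', hC', rfl⟩ := hy
    exact ⟨B + B', add_mem hB hB', C + C', add_mem hC hC', by rw [add_mul]; abel⟩
  | ι_mul A x hA =>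
    obtain ⟨B, hB, C, hC, rfl⟩ := hA
    obtain ⟨b, hb, c, hx⟩ := hgen x
    obtain ⟨B', hB', h1⟩ := e_last_mul_mem hB
    obtain ⟨C', hC', h2⟩ := e_last_mul_mem hC
    refine ⟨b * B - c • C', sub_mem (mul_mem hb hB) (Subalgebra.smul_mem _ hC' _),
      b * C + c • B', add_mem (mul_mem hb hC) (Subalgebra.smul_mem _ hB' _), ?_⟩
    have h3 : e (last n) * (C * e (last n)) = -C' := by
      rw [← mul_assoc, h2, mul_assoc, e_sq, mul_neg, mul_one]
    rw [hx, add_mul, mul_add, mul_add, smul_mul_assoc, smul_mul_assoc, h1, h3, add_mul,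
      smul_mul_assoc, smul_neg, mul_assoc]
    abel

/-- `Q'(A) = -e_n Q(A) e_n`. -/
def Q' {n : ℕ} [NeZero n] (A : Cl n) : Cl n := -(e (last n) * Q A * e (last n))

/-! ### Differential operators -/

/-- The Euclidean Dirac operator `D f = ∑ e_j ∂f/∂x_j`. -/
def dirac {n : ℕ} (f : E n → Cl n) (x : E n) : Cl n :=
  ∑ j : Fin n, e j * fderiv ℝ f x (stdVec j)

/-- The Dirac-Hodge operator `M f = D f + ((n-2)/x_n) Q'(f)` of upper half space. -/
def diracHodge {n : ℕ} [NeZero n] (f : E n → Cl n) (x : E n) : Cl n :=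
  dirac f x + (((n : ℝ) - 2) / x (last n)) • Q' (f x)

/-- The hyperbolic Laplacian `Δ f - ((n-2)/x_n) ∂f/∂x_n` of upper half space. -/
def hypLaplacian {n : ℕ} [NeZero n] (f : E n → Cl n) (x : E n) : Cl n :=
  Laplacian.laplacian f x - (((n : ℝ) - 2) / x (last n)) • fderiv ℝ f x (stdVec (last n))

/-! ### The kernels -/

/-- The surface area `ω_n` of the unit sphere in `ℝⁿ`. -/
def sphereArea (n : ℕ) : ℝ := (volume : Measure (E n)).toSphere.real univ

/-- `G(x, y) = ∫_{‖x-y‖/‖x-ŷ‖}^1 (1-t²)^{n-2} / t^{n-1} dt`. -/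
def green {n : ℕ} [NeZero n] (x y : E n) : ℝ :=
  ∫ t in (‖x - y‖ / ‖x - reflect n y‖)..1, (1 - t ^ 2) ^ (n - 2) / t ^ (n - 1)

/-- `h(x, y) = D_y G(x, y)`. -/
def cauchyKernel {n : ℕ} [NeZero n] (x y : E n) : Cl n :=
  dirac (fun z => algebraMap ℝ (Cl n) (green x z)) y

end UpperHalfSpace

end

noncomputable section

namespace UpperHalfSpace

open Filter Topology

/-! ### The radial profile of the Green kernel -/

/-! The kernel `G` depends on `(x, y)` only through `q = sinh²(d/2)`, where `d` is the hyperbolic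
distance. On functions of `q` the operator `y_n² △_{R^{n,+}}` becomes `q(1+q) f'' + (n/2)(1+2q) f'`,
and the profile of `G` solves the homogeneous equation for `q > 0`. The delta mass at `q = 0` is
found by regularization: `q` is replaced by `q + ε`, and the potential is written in two ways.

For `ε > 0` the kernel is smooth in `y`, so the operator passes under the integral sign onto the
kernel. The outcome is an explicit kernel, `approxKernel`. Rescaling by `√ε` around `y` shows it to
be an approximate identity (`tendsto_integral_approxKernel`), whose mass is a radial integral with
an elementary antiderivative.

For `ε ≥ 0`, the similarity of half space that carries `e_n` to `y` preserves `q`, so a change of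
variables freezes the singular kernel at `e_n` and moves all dependence on `y` into the smooth
density (`greenPotential_eq_integral_transported`). Derivatives in `y` then need only integrability
of the kernel: the potential is `C²` even at `ε = 0`, and its first two derivatives are limits of
the regularized ones (`tendsto_fderiv_greenPotential`). Singular second derivatives of `G` never
occur. Comparing the two forms as `ε → 0` gives `hypLap_greenPotential`.

For the kernel `h`, differentiation under the integral identifies its potential with `D u`, where
`u` is the Green potential (`integral_cauchyKernel`). On `Cl_{n-1}`-valued functions `M D =
-△_{R^{n,+}}`, because `D² = -△` and `Q'(D u) = ∂u/∂y_n` (`diracHodge_dirac`), so the second formula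
follows from the first. -/

/-- The Green kernel as a function of `q = sinh² (d/2)`, where `d` is the hyperbolic distance. -/
def greenProfile (n : ℕ) (q : ℝ) : ℝ :=
  ∫ t in √(q / (1 + q))..1, (1 - t ^ 2) ^ (n - 2) / t ^ (n - 1)

/-- The derivative of `greenProfile`. -/
def greenProfileDeriv (n : ℕ) (q : ℝ) : ℝ := -(1 / 2) * (√(q * (1 + q)))⁻¹ ^ n

/-- The second derivative of `greenProfile`. -/
def greenProfileDeriv₂ (n : ℕ) (q : ℝ) : ℝ :=
  (n / 4) * (1 + 2 * q) * (√(q * (1 + q)))⁻¹ ^ (n + 2)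

theorem sqrt_div_one_add_pos {q : ℝ} (hq : 0 < q) : 0 < √(q / (1 + q)) :=
  Real.sqrt_pos.2 (by positivity)

theorem sqrt_div_one_add_lt_one {q : ℝ} (hq : 0 < q) : √(q / (1 + q)) < 1 := by
  rw [Real.sqrt_lt' one_pos, one_pow, div_lt_one (by positivity)]
  linarith

/-- With `s = √(q/(1+q))` one has `1 - s² = 1/(1+q)` and `s(1+q) = √(q(1+q))`, so the powers coming
from the integrand and from `ds/dq` combine into a single power. -/
theorem hasDerivAt_greenProfile {n : ℕ} (hn : 2 ≤ n) {q : ℝ} (hq : 0 < q) :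
    HasDerivAt (greenProfile n) (greenProfileDeriv n q) q := by
  set s := √(q / (1 + q)) with hs
  have hs0 : 0 < s := sqrt_div_one_add_pos hq
  have hsq : s ^ 2 = q / (1 + q) := Real.sq_sqrt (by positivity)
  have hcont : ContinuousOn (fun t : ℝ => (1 - t ^ 2) ^ (n - 2) / t ^ (n - 1)) (Ioi 0) :=
    ContinuousOn.div (by fun_prop) (by fun_prop) fun t ht => pow_ne_zero _ (ne_of_gt ht)
  have h1 : HasDerivAt
      (fun u => ∫ t in u..1, (1 - t ^ 2) ^ (n - 2) / t ^ (n - 1))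
      (-((1 - s ^ 2) ^ (n - 2) / s ^ (n - 1))) s := by
    refine intervalIntegral.integral_hasDerivAt_left ?_ ?_ ?_
    · refine ContinuousOn.intervalIntegrable (hcont.mono ?_)
      intro t ht
      exact lt_of_lt_of_le (lt_min hs0 one_pos) ht.1
    · exact hcont.stronglyMeasurableAtFilter isOpen_Ioi s hs0
    · exact hcont.continuousAt (Ioi_mem_nhds hs0)
  have h2 : HasDerivAt (fun u : ℝ => √(u / (1 + u))) (1 / (1 + q) ^ 2 / (2 * s)) q := by
    have h3 : HasDerivAt (fun u : ℝ => u / (1 + u)) (1 / (1 + q) ^ 2) q := by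
      have h := (hasDerivAt_id q).div ((hasDerivAt_id q).const_add 1)
        (by simp only [id]; positivity)
      refine h.congr_deriv ?_
      simp only [id]
      congr 1
      ring
    exact h3.sqrt (by positivity)
  have h4 := h1.comp q h2
  refine h4.congr_deriv ?_
  have h5 : √(q * (1 + q)) = s * (1 + q) := by
    rw [Real.sqrt_eq_iff_mul_self_eq (by positivity) (by positivity)]
    have : s * (1 + q) * (s * (1 + q)) = s ^ 2 * (1 + q) ^ 2 := by ring
    rw [this, hsq]
    field_simp
  have h6 : 1 - s ^ 2 = (1 + q)⁻¹ := by rw [hsq]; field_simp; ring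
  obtain ⟨m, rfl⟩ := Nat.exists_eq_add_of_le hn
  rw [greenProfileDeriv, h5, h6]
  have e1 : 2 + m - 2 = m := by omega
  have e2 : 2 + m - 1 = m + 1 := by omega
  rw [e1, e2]
  have := hs0.ne'
  have : 1 + q ≠ 0 := by positivity
  simp only [inv_pow, mul_pow, pow_add]
  field_simp

theorem hasDerivAt_greenProfileDeriv (n : ℕ) {q : ℝ} (hq : 0 < q) :
    HasDerivAt (greenProfileDeriv n) (greenProfileDeriv₂ n q) q := by
  have hR : 0 < q * (1 + q) := by positivity
  have h1 : HasDerivAt (fun u : ℝ => u * (1 + u)) (1 + 2 * q) q := by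
    refine ((hasDerivAt_id q).mul ((hasDerivAt_id q).const_add 1)).congr_deriv ?_
    simp only [id]
    ring
  have h2 := (((h1.sqrt hR.ne').inv (Real.sqrt_pos.2 hR).ne').pow n).const_mul (-(1 / 2) : ℝ)
  refine h2.congr_deriv ?_
  rw [greenProfileDeriv₂]
  have := (Real.sqrt_pos.2 hR).ne'
  rcases n with _ | m
  · simp
  · simp only [Pi.inv_apply, Nat.add_sub_cancel, Nat.cast_add, Nat.cast_one, inv_pow, pow_add]
    field_simp
    ring

theorem contDiffOn_greenProfile {n : ℕ} (hn : 2 ≤ n) : ContDiffOn ℝ 2 (greenProfile n) (Ioi 0) := by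
  rw [show (2 : WithTop ℕ∞) = 1 + 1 by norm_num, contDiffOn_succ_iff_deriv_of_isOpen isOpen_Ioi]
  refine ⟨fun q hq => (hasDerivAt_greenProfile hn hq).differentiableAt.differentiableWithinAt,
    by simp, ?_⟩
  have : ContDiffOn ℝ 1 (greenProfileDeriv n) (Ioi 0) := by
    unfold greenProfileDeriv
    have h : ∀ q ∈ Ioi (0 : ℝ), q * (1 + q) ≠ 0 := fun q (hq : 0 < q) => by positivity
    have h1 : ContDiffOn ℝ 1 (fun q : ℝ => q * (1 + q)) (Ioi 0) := by fun_prop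
    exact contDiffOn_const.mul (((h1.sqrt h).inv fun q (hq : 0 < q) =>
      (Real.sqrt_pos.2 (by positivity)).ne').pow n)
  exact this.congr fun q hq => (hasDerivAt_greenProfile hn hq).deriv

/-- The integrand is largest at the lower limit and the interval has length at most one. For `n > 2`
this loses one power against the true singularity, yet order `n - 1` is still integrable in `ℝⁿ`. -/
theorem abs_greenProfile_le (n : ℕ) {q : ℝ} (hq : 0 < q) :
    |greenProfile n q| ≤ (√(q / (1 + q)))⁻¹ ^ (n - 1) := by
  have h0 := sqrt_div_one_add_pos hq
  have h1 := sqrt_div_one_add_lt_one hq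
  rw [greenProfile, ← Real.norm_eq_abs]
  refine (intervalIntegral.norm_integral_le_of_norm_le_const
    (C := (√(q / (1 + q)))⁻¹ ^ (n - 1)) ?_).trans ?_
  · intro t ht
    rw [uIoc_of_le h1.le] at ht
    have ht0 : 0 < t := h0.trans ht.1
    rw [norm_div, norm_pow, norm_pow, Real.norm_of_nonneg ht0.le, div_eq_mul_inv, ← inv_pow]
    have : ‖1 - t ^ 2‖ ≤ 1 := by
      rw [Real.norm_eq_abs, abs_le]; constructor <;> nlinarith [ht.2]
    calc ‖1 - t ^ 2‖ ^ (n - 2) * t⁻¹ ^ (n - 1) ≤ 1 * (√(q / (1 + q)))⁻¹ ^ (n - 1) := by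
          gcongr
          · exact pow_le_one₀ (norm_nonneg _) this
          · exact ht.1.le
      _ = _ := one_mul _
  · refine mul_le_of_le_one_right (by positivity) ?_
    rw [abs_of_nonneg (by linarith)]
    linarith

theorem sqrt_div_one_add_mono {p q : ℝ} (hp : 0 ≤ p) (h : p ≤ q) :
    √(p / (1 + p)) ≤ √(q / (1 + q)) := by
  refine Real.sqrt_le_sqrt ?_
  rw [div_le_div_iff₀ (by linarith) (by linarith)]
  nlinarith

/-- The bound is uniform in `ε`, hence a dominating function for `ε → 0`. -/
theorem abs_greenProfile_add_le (n : ℕ) {q ε : ℝ} (hq : 0 < q) (hε : 0 ≤ ε) :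
    |greenProfile n (q + ε)| ≤ (√(q / (1 + q)))⁻¹ ^ (n - 1) := by
  refine (abs_greenProfile_le n (by linarith)).trans ?_
  have := sqrt_div_one_add_pos hq
  have := sqrt_div_one_add_mono hq.le (le_add_of_nonneg_right hε)
  gcongr

theorem abs_greenProfileDeriv_add_le (n : ℕ) {q ε : ℝ} (hq : 0 < q) (hε : 0 ≤ ε) :
    |greenProfileDeriv n (q + ε)| ≤ |greenProfileDeriv n q| := by
  have : 0 < √(q * (1 + q)) := Real.sqrt_pos.2 (by positivity)
  rw [greenProfileDeriv, greenProfileDeriv, abs_mul, abs_mul, abs_pow, abs_pow, abs_inv, abs_inv,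
    abs_of_nonneg (Real.sqrt_nonneg _), abs_of_nonneg (Real.sqrt_nonneg _)]
  gcongr <;> linarith

/-- The radial part of the hyperbolic Laplacian, applied to `greenProfile n (· + ε)`. -/
def approxKernel (n : ℕ) (ε q : ℝ) : ℝ :=
  -(n / 4 * ε * (1 + q + (q + ε) + 2 * q * (q + ε)) *
    (√((q + ε) * (1 + (q + ε))))⁻¹ ^ (n + 2))

/-- The profile satisfies the radial equation at `p = q + ε`, while the coefficients are taken at
`q`. The mismatch `q(1+q)(1+2p) - (1+2q)p(1+p)` has the factor `q - p = -ε`. -/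
theorem radial_laplacian_greenProfile (n : ℕ) {q ε : ℝ} (hq : 0 ≤ q) (hε : 0 < ε) :
    q * (1 + q) * greenProfileDeriv₂ n (q + ε) + n / 2 * (1 + 2 * q) * greenProfileDeriv n (q + ε)
      = approxKernel n ε q := by
  have hR : 0 < (q + ε) * (1 + (q + ε)) := by positivity
  have h := Real.sq_sqrt hR.le
  have h0 := Real.sqrt_pos.2 hR
  rw [greenProfileDeriv₂, greenProfileDeriv, approxKernel]
  set R := √((q + ε) * (1 + (q + ε)))
  have : R⁻¹ ^ n = R⁻¹ ^ (n + 2) * ((q + ε) * (1 + (q + ε))) := by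
    rw [← h, pow_add]; field_simp
  rw [this]
  ring

/-! ### Integrals over a compact set depending smoothly on a parameter -/

section ParametricIntegral

theorem continuousOn_right {H X F : Type*} [TopologicalSpace H] [TopologicalSpace X]
    [TopologicalSpace F] {U : Set H} {V K : Set X} {Ψ : H → X → F}
    (hΨ : ContinuousOn (fun p : H × X => Ψ p.1 p.2) (U ×ˢ V)) {y : H}
    (hy : y ∈ U) (hKV : K ⊆ V) : ContinuousOn (Ψ y) K :=
  hΨ.comp (f := fun w => (y, w)) (by fun_prop) fun _ hw => mk_mem_prod hy (hKV hw)

variable {H X F : Type*} [NormedAddCommGroup H] [NormedSpace ℝ H]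
  [NormedAddCommGroup X] [NormedSpace ℝ X] [NormedAddCommGroup F] [NormedSpace ℝ F]
  {U : Set H} {V K : Set X} {f : X → ℝ} {Ψ : H → X → F}

/-- Partial differentiation in the first variable lowers the smoothness by one. -/
theorem contDiffOn_fderiv_left {m : WithTop ℕ∞} (hU : IsOpen U) (hV : IsOpen V)
    (hΨ : ContDiffOn ℝ (m + 1) (fun p : H × X => Ψ p.1 p.2) (U ×ˢ V)) :
    ContDiffOn ℝ m (fun p : H × X => fderiv ℝ (fun z => Ψ z p.2) p.1) (U ×ˢ V) := by
  have h := ((contDiffOn_succ_iff_fderiv_of_isOpen (hU.prod hV)).1 hΨ)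
  have h2 : ContDiffOn ℝ m (fun p : H × X => (fderiv ℝ (fun p : H × X => Ψ p.1 p.2) p).comp
      (ContinuousLinearMap.inl ℝ H X)) (U ×ˢ V) := h.2.2.clm_comp contDiffOn_const
  refine h2.congr fun p hp => ?_
  have h3 := (h.1.differentiableAt ((hU.prod hV).mem_nhds hp)).hasFDerivAt
  exact (HasFDerivAt.comp (f := fun z => (z, p.2)) (g := fun p : H × X => Ψ p.1 p.2) p.1 h3
    (hasFDerivAt_prodMk_left p.1 p.2)).fderiv

theorem differentiableAt_left (hU : IsOpen U) (hV : IsOpen V)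
    (hΨ : ContDiffOn ℝ 1 (fun p : H × X => Ψ p.1 p.2) (U ×ˢ V)) {y : H} (hy : y ∈ U) {w : X}
    (hw : w ∈ V) : DifferentiableAt ℝ (fun z => Ψ z w) y := by
  have h3 := ((hΨ.differentiableOn one_ne_zero).differentiableAt
    ((hU.prod hV).mem_nhds (mk_mem_prod hy hw))).hasFDerivAt
  exact (HasFDerivAt.comp (f := fun z => (z, w)) (g := fun p : H × X => Ψ p.1 p.2) y h3
    (hasFDerivAt_prodMk_left y w)).differentiableAt

variable [FiniteDimensional ℝ H] [MeasurableSpace X] [BorelSpace X] [SecondCountableTopology X]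
  {μ : Measure X}

/-- The weight `f` may be singular: the derivative of `Ψ` is bounded on the product of a closed ball
and `K`, so a multiple of `|f|` dominates. It serves both for the singular profile against a smooth
density and for a smooth kernel against a power of `x_n`. -/
theorem hasFDerivAt_setIntegral_smul (hU : IsOpen U) (hV : IsOpen V) (hK : IsCompact K)
    (hKV : K ⊆ V) (hf : IntegrableOn f K μ)
    (hΨ : ContDiffOn ℝ 1 (fun p : H × X => Ψ p.1 p.2) (U ×ˢ V)) {y : H} (hy : y ∈ U) :
    HasFDerivAt (fun y => ∫ w in K, f w • Ψ y w ∂μ)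
      (∫ w in K, f w • fderiv ℝ (fun z => Ψ z w) y ∂μ) y := by
  have : ProperSpace H := FiniteDimensional.proper ℝ H
  have hD : ContinuousOn (fun p : H × X => fderiv ℝ (fun z => Ψ z p.2) p.1) (U ×ˢ V) :=
    (contDiffOn_fderiv_left (m := 0) hU hV (by simpa using hΨ)).continuousOn
  obtain ⟨r, hr, hrU⟩ := Metric.nhds_basis_closedBall.mem_iff.1 (hU.mem_nhds hy)
  obtain ⟨C, hC⟩ := ((isCompact_closedBall y r).prod hK).exists_bound_of_continuousOn
    (hD.mono (prod_mono hrU hKV))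
  have hint : ∀ z ∈ U, IntegrableOn (fun w => f w • Ψ z w) K μ := fun z hz =>
    hf.smul_continuousOn (continuousOn_right hΨ.continuousOn hz hKV) hK
  refine hasFDerivAt_integral_of_dominated_of_fderiv_le (𝕜 := ℝ) (F := fun y w => f w • Ψ y w)
    (F' := fun y w => f w • fderiv ℝ (fun z => Ψ z w) y)
    (bound := fun w => ‖f w‖ * C)
    (Metric.ball_mem_nhds y hr) ?_ (hint y hy) ?_ ?_ (hf.norm.mul_const C) ?_
  · filter_upwards [hU.mem_nhds hy] with z hz using (hint z hz).aestronglyMeasurable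
  · exact (hf.smul_continuousOn (continuousOn_right
      (Ψ := fun y w => fderiv ℝ (fun z => Ψ z w) y) hD hy hKV) hK).aestronglyMeasurable
  · refine (ae_restrict_iff' hK.measurableSet).2 (.of_forall fun w hw z hz => ?_)
    rw [norm_smul]
    gcongr
    exact hC (z, w) (mk_mem_prod (Metric.ball_subset_closedBall hz) hw)
  · refine (ae_restrict_iff' hK.measurableSet).2 (.of_forall fun w hw z hz => ?_)
    exact (differentiableAt_left hU hV hΨ (hrU (Metric.ball_subset_closedBall hz))
      (hKV hw)).hasFDerivAt.const_smul (f w)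

theorem fderiv_fderiv_setIntegral_smul (hU : IsOpen U) (hV : IsOpen V) (hK : IsCompact K)
    (hKV : K ⊆ V) (hf : IntegrableOn f K μ)
    (hΨ : ContDiffOn ℝ 2 (fun p : H × X => Ψ p.1 p.2) (U ×ˢ V)) {y : H} (hy : y ∈ U) :
    fderiv ℝ (fderiv ℝ (fun y => ∫ w in K, f w • Ψ y w ∂μ)) y =
      ∫ w in K, f w • fderiv ℝ (fderiv ℝ (fun z => Ψ z w)) y ∂μ := by
  have h1 : fderiv ℝ (fun y => ∫ w in K, f w • Ψ y w ∂μ) =ᶠ[𝓝 y]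
      fun y => ∫ w in K, f w • fderiv ℝ (fun z => Ψ z w) y ∂μ := by
    filter_upwards [hU.mem_nhds hy] with z hz
    exact (hasFDerivAt_setIntegral_smul hU hV hK hKV hf (hΨ.of_le one_le_two) hz).fderiv
  rw [h1.fderiv_eq]
  exact (hasFDerivAt_setIntegral_smul (Ψ := fun y w => fderiv ℝ (fun z => Ψ z w) y) hU hV hK hKV hf
    (contDiffOn_fderiv_left (m := 1) hU hV hΨ) hy).fderiv

/-- Three derivatives of `Ψ` are requested so that the second derivative of the integral is
differentiable, which supplies its continuity. -/
theorem contDiffOn_setIntegral_smul (hU : IsOpen U) (hV : IsOpen V) (hK : IsCompact K)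
    (hKV : K ⊆ V) (hf : IntegrableOn f K μ)
    (hΨ : ContDiffOn ℝ 3 (fun p : H × X => Ψ p.1 p.2) (U ×ˢ V)) :
    ContDiffOn ℝ 2 (fun y => ∫ w in K, f w • Ψ y w ∂μ) U := by
  have h1 : ContDiffOn ℝ 2 (fun p : H × X => fderiv ℝ (fun z => Ψ z p.2) p.1) (U ×ˢ V) :=
    contDiffOn_fderiv_left (m := 2) hU hV (by norm_num; exact hΨ)
  have h2 : ContDiffOn ℝ 1 (fun p : H × X => fderiv ℝ (fun z => fderiv ℝ (fun z => Ψ z p.2) z) p.1)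
      (U ×ˢ V) :=
    contDiffOn_fderiv_left (Ψ := fun y w => fderiv ℝ (fun z => Ψ z w) y) (m := 1) hU hV
      (by norm_num; exact h1)
  have d0 := fun y hy => hasFDerivAt_setIntegral_smul hU hV hK hKV hf
    (hΨ.of_le (by norm_num)) (y := y) hy
  have d1 := fun y hy => hasFDerivAt_setIntegral_smul (Ψ := fun y w => fderiv ℝ (fun z => Ψ z w) y)
    hU hV hK hKV hf (h1.of_le (by norm_num)) (y := y) hy
  have d2 := fun y hy => hasFDerivAt_setIntegral_smul
    (Ψ := fun y w => fderiv ℝ (fun z => fderiv ℝ (fun z => Ψ z w) z) y)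
    hU hV hK hKV hf h2 (y := y) hy
  rw [show (2 : WithTop ℕ∞) = 0 + 1 + 1 by norm_num, contDiffOn_succ_iff_fderiv_of_isOpen hU]
  refine ⟨fun y hy => (d0 y hy).differentiableAt.differentiableWithinAt, by simp, ?_⟩
  refine ContDiffOn.congr ?_ fun y hy => (d0 y hy).fderiv
  rw [contDiffOn_succ_iff_fderiv_of_isOpen hU]
  refine ⟨fun y hy => (d1 y hy).differentiableAt.differentiableWithinAt, by simp, ?_⟩
  refine ContDiffOn.congr ?_ fun y hy => (d1 y hy).fderiv
  rw [contDiffOn_zero]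
  exact fun y hy => (d2 y hy).continuousAt.continuousWithinAt

end ParametricIntegral

theorem tendsto_setIntegral_smul {ι X F : Type*} {l : Filter ι} [l.IsCountablyGenerated]
    [NormedAddCommGroup X] [MeasurableSpace X] [BorelSpace X] [NormedAddCommGroup F]
    [NormedSpace ℝ F] {μ : Measure X} {K : Set X} {f : X → ℝ}
    (hK : IsCompact K) {fi : ι → X → ℝ} {g : X → ℝ} {Φ : X → F}
    (hfi : ∀ᶠ i in l, AEStronglyMeasurable (fi i) (μ.restrict K))
    (hg : IntegrableOn g K μ) (hle : ∀ᶠ i in l, ∀ᵐ w ∂μ.restrict K, |fi i w| ≤ g w)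
    (hlim : ∀ᵐ w ∂μ.restrict K, Tendsto (fun i => fi i w) l (𝓝 (f w)))
    (hΦ : ContinuousOn Φ K) :
    Tendsto (fun i => ∫ w in K, fi i w • Φ w ∂μ) l (𝓝 (∫ w in K, f w • Φ w ∂μ)) := by
  obtain ⟨C, hC⟩ := hK.exists_bound_of_continuousOn hΦ
  have hΦm : AEStronglyMeasurable Φ (μ.restrict K) :=
    hΦ.aestronglyMeasurable_of_isCompact hK hK.measurableSet
  refine tendsto_integral_filter_of_dominated_convergence (fun w => g w * C) ?_ ?_
    (hg.mul_const C) ?_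
  · filter_upwards [hfi] with i hi using hi.smul hΦm
  · filter_upwards [hle] with i hi
    filter_upwards [hi, ae_restrict_mem hK.measurableSet] with w hw hwK
    rw [norm_smul, Real.norm_eq_abs]
    have := hC w hwK
    have := (abs_nonneg _).trans hw
    gcongr
  · filter_upwards [hlim] with w hw using hw.smul_const _

/-! ### The Green kernel as a function of the hyperbolic distance -/

section Distance

variable {n : ℕ}

theorem inner_stdVec (v : E n) (j : Fin n) : ⟪v, stdVec j⟫ = v j := by
  simp [stdVec, EuclideanSpace.inner_single_right]

theorem norm_stdVec (j : Fin n) : ‖(stdVec j : E n)‖ = 1 := by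
  simp [stdVec]

theorem hasFDerivAt_apply (j : Fin n) (y : E n) :
    HasFDerivAt (fun z : E n => z j) (EuclideanSpace.proj (𝕜 := ℝ) j) y :=
  (EuclideanSpace.proj (𝕜 := ℝ) j).hasFDerivAt

variable [NeZero n]

/-- The quantity `sinh² (d(x,y)/2)`, where `d` is the hyperbolic distance of `x` and `y`. -/
def sinhSq (x y : E n) : ℝ := ‖x - y‖ ^ 2 / (4 * x (last n) * y (last n))

theorem sinhSq_nonneg {x y : E n} (hx : x ∈ halfSpace n) (hy : y ∈ halfSpace n) :
    0 ≤ sinhSq x y := by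
  have hx : 0 < x (last n) := hx
  have hy : 0 < y (last n) := hy
  rw [sinhSq]; positivity

theorem sinhSq_pos {x y : E n} (hx : x ∈ halfSpace n) (hy : y ∈ halfSpace n) (h : x ≠ y) :
    0 < sinhSq x y := by
  have hx : 0 < x (last n) := hx
  have hy : 0 < y (last n) := hy
  have := norm_pos_iff.2 (sub_ne_zero.2 h)
  rw [sinhSq]; positivity

theorem stdVec_apply_last (j : Fin n) : (stdVec j : E n) (last n) = if j = last n then 1 else 0 := by
  simp [stdVec, eq_comm]

theorem norm_sub_reflect_sq (x y : E n) :
    ‖x - reflect n y‖ ^ 2 = ‖x - y‖ ^ 2 + 4 * x (last n) * y (last n) := by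
  rw [reflect_eq, show x - (y - (2 * y (last n)) • stdVec (last n)) =
    (x - y) + (2 * y (last n)) • stdVec (last n) by abel, norm_add_sq_real, inner_smul_right,
    inner_stdVec, norm_smul, norm_stdVec, mul_one, Real.norm_eq_abs, sq_abs]
  simp only [PiLp.sub_apply]
  ring

/-- Both sides are `tanh(d/2)`: the squared norms are `4 x_n y_n q` and `4 x_n y_n (1 + q)`. -/
theorem norm_div_norm_reflect {x y : E n} (hx : x ∈ halfSpace n) (hy : y ∈ halfSpace n) :
    ‖x - y‖ / ‖x - reflect n y‖ = √(sinhSq x y / (1 + sinhSq x y)) := by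
  have hx : 0 < x (last n) := hx
  have hy : 0 < y (last n) := hy
  rw [eq_comm, Real.sqrt_eq_iff_eq_sq, div_pow, norm_sub_reflect_sq, sinhSq]
  · field_simp
    ring
  · have := sinhSq_nonneg hx hy; positivity
  · positivity

theorem green_eq {x y : E n} (hx : x ∈ halfSpace n) (hy : y ∈ halfSpace n) :
    green x y = greenProfile n (sinhSq x y) := by
  rw [green, norm_div_norm_reflect hx hy, greenProfile]

theorem isOpen_halfSpace : IsOpen (halfSpace n) :=
  isOpen_lt continuous_const (EuclideanSpace.proj (𝕜 := ℝ) (last n)).continuous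

/-- The derivative of `sinhSq x` at `y`. -/
def sinhSqDeriv (x y : E n) : E n →L[ℝ] ℝ :=
  -(2 * x (last n) * y (last n))⁻¹ • innerSL ℝ (x - y)
    - (sinhSq x y / y (last n)) • EuclideanSpace.proj (last n)

theorem sinhSqDeriv_apply (x y v : E n) : sinhSqDeriv x y v =
    -(2 * x (last n) * y (last n))⁻¹ * ⟪x - y, v⟫ - sinhSq x y / y (last n) * v (last n) := by
  simp [sinhSqDeriv, inner_sub_left]

theorem hasFDerivAt_sinhSq {x y : E n} (hx : x ∈ halfSpace n) (hy : y ∈ halfSpace n) :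
    HasFDerivAt (sinhSq x) (sinhSqDeriv x y) y := by
  have hx : 0 < x (last n) := hx
  have hy : 0 < y (last n) := hy
  have h1 : HasFDerivAt (fun z : E n => ‖x - z‖ ^ 2) (-((2 : ℝ) • innerSL ℝ (x - y))) y := by
    refine (((hasFDerivAt_id y).const_sub x).norm_sq).congr_fderiv ?_
    ext v; simp; ring
  have h2 := (hasFDerivAt_apply (last n) y).const_mul (4 * x (last n))
  have h3 := (hasDerivAt_inv (by positivity)).comp_hasFDerivAt y h2
  refine (h1.mul h3).congr_fderiv ?_
  ext v
  simp [sinhSqDeriv_apply, sinhSq, inner_sub_left]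
  field_simp
  ring

/-- A Laplacian uses second derivatives on the diagonal `(v, v)` only, so the full derivative stays
existential. -/
theorem hasFDerivAt_sinhSqDeriv_apply {x y : E n} (hx : x ∈ halfSpace n) (hy : y ∈ halfSpace n)
    (v : E n) : ∃ L : E n →L[ℝ] ℝ, HasFDerivAt (fun z => sinhSqDeriv x z v) L y ∧
      L v = ‖v‖ ^ 2 / (2 * x (last n) * y (last n))
        + ⟪x - y, v⟫ * v (last n) / (x (last n) * y (last n) ^ 2)
        + 2 * sinhSq x y * v (last n) ^ 2 / y (last n) ^ 2 := by
  have hq := hasFDerivAt_sinhSq hx hy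
  have hx : 0 < x (last n) := hx
  have hy : 0 < y (last n) := hy
  simp only [sinhSqDeriv_apply]
  have h2 := ((hasFDerivAt_apply (last n) y).const_mul (2 * x (last n)))
  have h3 := ((hasDerivAt_inv (by positivity)).comp_hasFDerivAt y h2).neg
  have h4 : HasFDerivAt (fun z : E n => ⟪x - z, v⟫) (-(innerSL ℝ v)) y := by
    refine (((hasFDerivAt_id y).const_sub x).inner ℝ (hasFDerivAt_const v y)).congr_fderiv ?_
    ext w; simp [real_inner_comm]
  have h5 := (hq.mul ((hasDerivAt_inv hy.ne').comp_hasFDerivAt y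
    (hasFDerivAt_apply (last n) y))).mul_const (v (last n))
  refine ⟨_, (h3.mul h4).sub h5, ?_⟩
  simp [sinhSqDeriv_apply, inner_sub_left]
  field_simp
  ring

end Distance

/-! ### The hyperbolic Laplacian of the regularized Green kernel -/

section HyperbolicLaplacian

variable {n : ℕ} [NeZero n] {F : Type*} [NormedAddCommGroup F] [NormedSpace ℝ F]

/-- The hyperbolic Laplacian of a function with values in a normed space, in terms of second
directional derivatives. -/
def hypLap (f : E n → F) (y : E n) : F :=
  ∑ j : Fin n, fderiv ℝ (fderiv ℝ f) y (stdVec j) (stdVec j)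
    - (((n : ℝ) - 2) / y (last n)) • fderiv ℝ f y (stdVec (last n))

theorem hypLaplacian_eq (f : E n → Cl n) (y : E n) : hypLaplacian f y = hypLap f y := by
  rw [hypLaplacian, hypLap, InnerProductSpace.laplacian_eq_iteratedFDeriv_orthonormalBasis f
    (EuclideanSpace.basisFun (Fin n) ℝ)]
  simp [iteratedFDeriv_two_apply, stdVec]

theorem hypLap_smul_const {g : E n → ℝ} {y : E n} (hg : ContDiffAt ℝ 2 g y) (c : F) :
    hypLap (fun z => g z • c) y = hypLap g y • c := by
  have h1 : fderiv ℝ (fun z => g z • c) =ᶠ[𝓝 y] fun z => (fderiv ℝ g z).smulRight c := by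
    filter_upwards [hg.eventually (by simp)] with z hz
    rw [fderiv_smul_const (hz.differentiableAt (by simp))]
  have h2 : DifferentiableAt ℝ (fderiv ℝ g) y :=
    (hg.fderiv_right (m := 1) (by norm_num)).differentiableAt (by simp)
  have h3 : fderiv ℝ (fun z => (fderiv ℝ g z).smulRight c) y =
      ((ContinuousLinearMap.smulRightL ℝ (E n) F).flip c).comp (fderiv ℝ (fderiv ℝ g) y) :=
    (((ContinuousLinearMap.smulRightL ℝ (E n) F).flip c).hasFDerivAt.comp y h2.hasFDerivAt).fderiv
  rw [hypLap, hypLap, h1.fderiv_eq, h1.eq_of_nhds, h3]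
  simp [sub_smul, Finset.sum_smul, mul_smul]

theorem contDiffOn_sinhSq :
    ContDiffOn ℝ ∞ (fun p : E n × E n => sinhSq p.2 p.1) (halfSpace n ×ˢ halfSpace n) := by
  unfold sinhSq
  have h (j : Fin n) : ContDiff ℝ ∞ (fun x : E n => x j) :=
    (EuclideanSpace.proj (𝕜 := ℝ) j).contDiff
  refine ContDiffOn.div ?_ ?_ fun p hp => ?_
  · exact ((contDiff_snd.sub contDiff_fst).norm_sq ℝ).contDiffOn
  · exact ((contDiff_const.mul ((h _).comp contDiff_snd)).mul
      ((h _).comp contDiff_fst)).contDiffOn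
  · have h1 : 0 < p.1 (last n) := hp.1
    have h2 : 0 < p.2 (last n) := hp.2
    positivity

theorem contDiffOn_greenProfile_sinhSq (hn : 2 ≤ n) {ε : ℝ} (hε : 0 < ε) :
    ContDiffOn ℝ 2 (fun p : E n × E n => greenProfile n (sinhSq p.2 p.1 + ε))
      (halfSpace n ×ˢ halfSpace n) := by
  refine (contDiffOn_greenProfile hn).comp
    ((contDiffOn_sinhSq.of_le (ENat.LEInfty.out)).add contDiffOn_const) fun p hp => ?_
  have := sinhSq_nonneg hp.2 hp.1
  exact add_pos_of_nonneg_of_pos this hε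

theorem hasFDerivAt_greenProfile_sinhSq (hn : 2 ≤ n) {ε : ℝ} {x y : E n} (hx : x ∈ halfSpace n)
    (hy : y ∈ halfSpace n) (h : 0 < sinhSq x y + ε) :
    HasFDerivAt (fun z => greenProfile n (sinhSq x z + ε))
      (greenProfileDeriv n (sinhSq x y + ε) • sinhSqDeriv x y) y :=
  HasDerivAt.comp_hasFDerivAt (h₂ := greenProfile n) y (hasDerivAt_greenProfile hn h) ((hasFDerivAt_sinhSq hx hy).add_const ε)

theorem contDiffAt_greenProfile_sinhSq (hn : 2 ≤ n) {ε : ℝ} (hε : 0 < ε) {x y : E n}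
    (hx : x ∈ halfSpace n) (hy : y ∈ halfSpace n) :
    ContDiffAt ℝ 2 (fun z => greenProfile n (sinhSq x z + ε)) y := by
  have h := (contDiffOn_greenProfile_sinhSq hn hε).contDiffAt
    ((isOpen_halfSpace.prod isOpen_halfSpace).mem_nhds (mk_mem_prod hy hx))
  exact h.comp (f := fun z => (z, x)) y (by fun_prop)

theorem fderiv_fderiv_greenProfile_sinhSq (hn : 2 ≤ n) {ε : ℝ} (hε : 0 < ε) {x y : E n}
    (hx : x ∈ halfSpace n) (hy : y ∈ halfSpace n) (v : E n) :
    fderiv ℝ (fderiv ℝ (fun z => greenProfile n (sinhSq x z + ε))) y v v =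
      greenProfileDeriv₂ n (sinhSq x y + ε) * sinhSqDeriv x y v ^ 2 +
      greenProfileDeriv n (sinhSq x y + ε) * (‖v‖ ^ 2 / (2 * x (last n) * y (last n))
        + ⟪x - y, v⟫ * v (last n) / (x (last n) * y (last n) ^ 2)
        + 2 * sinhSq x y * v (last n) ^ 2 / y (last n) ^ 2) := by
  set g := fun z => greenProfile n (sinhSq x z + ε)
  have hpos : ∀ z ∈ halfSpace n, 0 < sinhSq x z + ε := fun z hz =>
    add_pos_of_nonneg_of_pos (sinhSq_nonneg hx hz) hε
  have h2 : DifferentiableAt ℝ (fderiv ℝ g) y :=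
    ((contDiffAt_greenProfile_sinhSq hn hε hx hy).fderiv_right (m := 1) (by norm_num)).differentiableAt
      (by simp)
  have h3 : fderiv ℝ (fderiv ℝ g) y v v = fderiv ℝ (fun z => fderiv ℝ g z v) y v := by
    rw [fderiv_clm_apply h2 (differentiableAt_const v)]
    simp
  have h4 : (fun z => fderiv ℝ g z v) =ᶠ[𝓝 y]
      fun z => greenProfileDeriv n (sinhSq x z + ε) * sinhSqDeriv x z v := by
    filter_upwards [isOpen_halfSpace.mem_nhds hy] with z hz
    rw [(hasFDerivAt_greenProfile_sinhSq hn hx hz (hpos z hz)).fderiv]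
    rfl
  obtain ⟨L, hL, hLv⟩ := hasFDerivAt_sinhSqDeriv_apply hx hy v
  have h5 : HasFDerivAt (fun z => greenProfileDeriv n (sinhSq x z + ε)) _ y :=
    HasDerivAt.comp_hasFDerivAt (h₂ := greenProfileDeriv n) y
      (hasDerivAt_greenProfileDeriv n (hpos y hy)) ((hasFDerivAt_sinhSq hx hy).add_const ε)
  rw [h3, h4.fderiv_eq, (h5.fun_mul hL).fderiv, ← hLv]
  simp
  ring

/-- By the chain rule two identities suffice: `∑ (∂_j q)² = q(1+q)/y_n²`, and the hyperbolic
Laplacian of `q` is `(n/2)(1+2q)/y_n²`. -/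
theorem hypLap_greenProfile_sinhSq (hn : 2 ≤ n) {ε : ℝ} (hε : 0 < ε) {x y : E n}
    (hx : x ∈ halfSpace n) (hy : y ∈ halfSpace n) :
    hypLap (fun z => greenProfile n (sinhSq x z + ε)) y =
      (y (last n) ^ 2)⁻¹ * approxKernel n ε (sinhSq x y) := by
  rw [hypLap, (hasFDerivAt_greenProfile_sinhSq hn hx hy
    (add_pos_of_nonneg_of_pos (sinhSq_nonneg hx hy) hε)).fderiv,
    ← radial_laplacian_greenProfile n (sinhSq_nonneg hx hy) hε]
  simp only [fderiv_fderiv_greenProfile_sinhSq hn hε hx hy, sinhSqDeriv_apply, inner_stdVec,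
    norm_stdVec, stdVec_apply_last, Finset.sum_add_distrib, ← Finset.mul_sum]
  set A := greenProfileDeriv n (sinhSq x y + ε)
  set B := greenProfileDeriv₂ n (sinhSq x y + ε)
  have hs : ∑ j : Fin n, (x - y) j ^ 2 = 4 * x (last n) * y (last n) * sinhSq x y := by
    have h1 : 0 < y (last n) := hy
    have h2 : 0 < x (last n) := hx
    rw [← EuclideanSpace.real_norm_sq_eq, sinhSq]
    field_simp
  have e1 : ∑ j : Fin n, (-(2 * x (last n) * y (last n))⁻¹ * (x - y) j
      - sinhSq x y / y (last n) * if j = last n then 1 else 0) ^ 2 =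
      sinhSq x y * (1 + sinhSq x y) / y (last n) ^ 2 := by
    have : ∀ j : Fin n, (-(2 * x (last n) * y (last n))⁻¹ * (x - y) j
      - sinhSq x y / y (last n) * if j = last n then 1 else 0) ^ 2 =
      ((2 * x (last n) * y (last n))⁻¹) ^ 2 * (x - y) j ^ 2 + (if j = last n then
        2 * (2 * x (last n) * y (last n))⁻¹ * (x - y) j * (sinhSq x y / y (last n)) +
          (sinhSq x y / y (last n)) ^ 2 else 0) := by
      intro j; split_ifs <;> ring
    rw [Finset.sum_congr rfl fun j _ => this j, Finset.sum_add_distrib, ← Finset.mul_sum, hs]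
    simp only [Finset.sum_ite_eq', Finset.mem_univ, if_true, PiLp.sub_apply]
    have h1 : 0 < y (last n) := hy
    have h2 : 0 < x (last n) := hx
    field_simp
    ring
  rw [e1]
  have h1 : 0 < y (last n) := hy
  have h2 : 0 < x (last n) := hx
  simp [inner_stdVec, stdVec_apply_last, sinhSqDeriv_apply, ite_div]
  field_simp
  ring

end HyperbolicLaplacian

/-! ### Integrability of the Green kernel -/

section Integrability

variable {n : ℕ} [NeZero n]

theorem nontrivial_E : Nontrivial (E n) :=
  ⟨⟨stdVec (last n), 0, fun h => by simpa [h] using norm_stdVec (last n)⟩⟩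

/-- In polar coordinates the Jacobian `t^(n-1)` cancels the singularity exactly, leaving a constant
on a bounded interval. -/
theorem integrableOn_inv_norm_sub_pow (y : E n) {K : Set (E n)} (hK : IsCompact K) :
    IntegrableOn (fun x => ‖x - y‖⁻¹ ^ (n - 1)) K := by
  have := nontrivial_E (n := n)
  obtain ⟨r, hr⟩ := hK.isBounded.subset_ball y
  have h1 : IntegrableOn (fun x : E n => ‖x‖⁻¹ ^ (n - 1)) (Metric.ball 0 r) := by
    rw [integrableOn_fun_norm_addHaar volume (f := fun t => t⁻¹ ^ (n - 1))]
    refine IntegrableOn.congr_fun (f := fun _ => (1 : ℝ)) ?_ ?_ measurableSet_Ioo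
    · exact integrableOn_const (by simp)
    · intro t ht
      have : 0 < t := ht.1
      simp only [finrank_euclideanSpace, Fintype.card_fin, smul_eq_mul, ← mul_pow]
      rw [mul_inv_cancel₀ this.ne', one_pow]
  have h2 := ((measurePreserving_sub_right volume y).integrableOn_comp_preimage
    (MeasurableEquiv.subRight y).measurableEmbedding).2 h1
  refine IntegrableOn.mono_set h2 (hr.trans fun x hx => ?_)
  simpa [dist_eq_norm] using hx

theorem aestronglyMeasurable_of_continuousOn_diff_singleton {F : Type*} [TopologicalSpace F]
    [TopologicalSpace.PseudoMetrizableSpace F] {f : E n → F} {K : Set (E n)}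
    (hK : MeasurableSet K) (y : E n) (hf : ContinuousOn f (K \ {y})) :
    AEStronglyMeasurable f (volume.restrict K) := by
  have := nontrivial_E (n := n)
  have h : (K \ {y} : Set (E n)) =ᵐ[volume] K := sdiff_null_ae_eq_self (measure_singleton y)
  rw [← Measure.restrict_congr_set h]
  exact hf.aestronglyMeasurable (hK.diff (measurableSet_singleton y))

theorem ae_restrict_ne {K : Set (E n)} (y : E n) : ∀ᵐ x ∂volume.restrict K, x ≠ y := by
  have := nontrivial_E (n := n)
  exact Measure.ae_ne _ y

theorem norm_sub_reflect_pos {x y : E n} (hx : x ∈ halfSpace n) (hy : y ∈ halfSpace n) :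
    0 < ‖x - reflect n y‖ := by
  have hx : 0 < x (last n) := hx
  have hy : 0 < y (last n) := hy
  have := norm_sub_reflect_sq x y
  refine (norm_nonneg _).lt_of_ne fun h => ?_
  rw [← h] at this
  nlinarith [sq_nonneg ‖x - y‖, mul_pos hx hy]

theorem continuousOn_sinhSq {y : E n} (hy : y ∈ halfSpace n) :
    ContinuousOn (fun x => sinhSq x y) (halfSpace n) :=
  continuousOn_right (Ψ := fun y x => sinhSq x y) contDiffOn_sinhSq.continuousOn hy subset_rfl

variable {K : Set (E n)} {y : E n}

theorem integrableOn_greenProfile_bound (hK : IsCompact K) (hKH : K ⊆ halfSpace n)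
    (hy : y ∈ halfSpace n) :
    IntegrableOn (fun x => (√(sinhSq x y / (1 + sinhSq x y)))⁻¹ ^ (n - 1)) K := by
  have h : IntegrableOn (fun x => ‖x - y‖⁻¹ ^ (n - 1) * ‖x - reflect n y‖ ^ (n - 1)) K :=
    (integrableOn_inv_norm_sub_pow y hK).mul_continuousOn (by fun_prop) hK
  refine h.congr_fun (fun x hx => ?_) hK.measurableSet
  simp only
  rw [← norm_div_norm_reflect (hKH hx) hy, inv_div, div_eq_inv_mul, mul_pow]

theorem aestronglyMeasurable_greenProfile (hn : 2 ≤ n) (hK : IsCompact K) (hKH : K ⊆ halfSpace n)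
    (hy : y ∈ halfSpace n) {ε : ℝ} (hε : 0 ≤ ε) :
    AEStronglyMeasurable (fun x => greenProfile n (sinhSq x y + ε)) (volume.restrict K) := by
  refine aestronglyMeasurable_of_continuousOn_diff_singleton hK.measurableSet y ?_
  refine (contDiffOn_greenProfile hn).continuousOn.comp
    (((continuousOn_sinhSq hy).mono (sdiff_subset.trans hKH)).add continuousOn_const) fun x hx => ?_
  exact add_pos_of_pos_of_nonneg (sinhSq_pos (hKH hx.1) hy hx.2) hε

theorem ae_abs_greenProfile_le (hK : IsCompact K) (hKH : K ⊆ halfSpace n)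
    (hy : y ∈ halfSpace n) {ε : ℝ} (hε : 0 ≤ ε) :
    ∀ᵐ x ∂volume.restrict K, |greenProfile n (sinhSq x y + ε)| ≤
      (√(sinhSq x y / (1 + sinhSq x y)))⁻¹ ^ (n - 1) := by
  filter_upwards [ae_restrict_ne y, ae_restrict_mem hK.measurableSet] with x hxy hx
  exact abs_greenProfile_add_le n (sinhSq_pos (hKH hx) hy hxy) hε

theorem integrableOn_greenProfile (hn : 2 ≤ n) (hK : IsCompact K) (hKH : K ⊆ halfSpace n)
    (hy : y ∈ halfSpace n) {ε : ℝ} (hε : 0 ≤ ε) :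
    IntegrableOn (fun x => greenProfile n (sinhSq x y + ε)) K :=
  (integrableOn_greenProfile_bound hK hKH hy).mono'
    (aestronglyMeasurable_greenProfile hn hK hKH hy hε) (ae_abs_greenProfile_le hK hKH hy hε)

theorem continuousOn_sinhSqDeriv_apply (hy : y ∈ halfSpace n) (v : E n) :
    ContinuousOn (fun x => sinhSqDeriv x y v) (halfSpace n) := by
  simp only [sinhSqDeriv_apply]
  have h1 : ContinuousOn (fun x : E n => -(2 * x (last n) * y (last n))⁻¹) (halfSpace n) := by
    refine (ContinuousOn.inv₀ (by fun_prop) fun x hx => ?_).neg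
    have hx : 0 < x (last n) := hx
    have hy : 0 < y (last n) := hy
    positivity
  refine (h1.mul (by fun_prop)).sub (((continuousOn_sinhSq hy).div_const _).mul_const _)

theorem sqrt_sinhSq_mul {x : E n} (hx : x ∈ halfSpace n) (hy : y ∈ halfSpace n) :
    √(sinhSq x y * (1 + sinhSq x y)) =
      ‖x - y‖ * (‖x - reflect n y‖ / (4 * x (last n) * y (last n))) := by
  have h0 := sinhSq_nonneg hx hy
  have hx : 0 < x (last n) := hx
  have hy : 0 < y (last n) := hy
  rw [Real.sqrt_eq_iff_eq_sq (by positivity) (by positivity), mul_pow, div_pow,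
    norm_sub_reflect_sq, sinhSq]
  field_simp
  ring

theorem aestronglyMeasurable_greenProfileDeriv (hK : IsCompact K) (hKH : K ⊆ halfSpace n)
    (hy : y ∈ halfSpace n) {ε : ℝ} (hε : 0 ≤ ε) (v : E n) :
    AEStronglyMeasurable (fun x => greenProfileDeriv n (sinhSq x y + ε) * sinhSqDeriv x y v)
      (volume.restrict K) := by
  refine aestronglyMeasurable_of_continuousOn_diff_singleton hK.measurableSet y ?_
  have h1 : ContinuousOn (greenProfileDeriv n) (Ioi 0) := fun q hq =>
    (hasDerivAt_greenProfileDeriv n hq).continuousAt.continuousWithinAt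
  refine (h1.comp (((continuousOn_sinhSq hy).mono (sdiff_subset.trans hKH)).add
    continuousOn_const) fun x hx => ?_).mul ((continuousOn_sinhSqDeriv_apply hy v).mono
    (sdiff_subset.trans hKH))
  exact add_pos_of_pos_of_nonneg (sinhSq_pos (hKH hx.1) hy hx.2) hε

/-- Near `x = y` the profile derivative has order `‖x - y‖^(-n)` and `∂q` has order `‖x - y‖`, so
the product has the integrable order `‖x - y‖^(1-n)`. -/
theorem integrableOn_greenProfileDeriv (hn : 2 ≤ n) (hK : IsCompact K) (hKH : K ⊆ halfSpace n)
    (hy : y ∈ halfSpace n) (v : E n) :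
    IntegrableOn (fun x => greenProfileDeriv n (sinhSq x y) * sinhSqDeriv x y v) K := by
  -- This is the factor that remains in the bound once `‖x - y‖^(1-n)` is split off.
  have hc : ContinuousOn (fun x => 1 / 2 *
      (4 * x (last n) * y (last n) / ‖x - reflect n y‖) ^ n *
      (((2 * x (last n) * y (last n))⁻¹ + ‖x - y‖ / (4 * x (last n) * y (last n) ^ 2)) * ‖v‖))
      (halfSpace n) := by
    have hpos : ∀ x ∈ halfSpace n, 0 < x (last n) := fun x hx => hx
    have hy' : 0 < y (last n) := hy
    refine ContinuousOn.mul (continuousOn_const.mul (ContinuousOn.pow ?_ n))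
      (ContinuousOn.mul (ContinuousOn.add ?_ ?_) continuousOn_const)
    · exact ContinuousOn.div (by fun_prop) (by fun_prop) fun x hx =>
        (norm_sub_reflect_pos hx hy).ne'
    · refine ContinuousOn.inv₀ (by fun_prop) fun x hx => ?_
      have := hpos x hx
      positivity
    · refine ContinuousOn.div (by fun_prop) (by fun_prop) fun x hx => ?_
      have := hpos x hx
      positivity
  have h : IntegrableOn (fun x => ‖x - y‖⁻¹ ^ (n - 1) * _) K :=
    (integrableOn_inv_norm_sub_pow y hK).mul_continuousOn (hc.mono hKH) hK
  refine h.mono' (by simpa using aestronglyMeasurable_greenProfileDeriv hK hKH hy le_rfl v) ?_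
  filter_upwards [ae_restrict_ne y, ae_restrict_mem hK.measurableSet] with x hxy hx
  have hr := norm_sub_reflect_pos (hKH hx) hy
  have hs := sqrt_sinhSq_mul (hKH hx) hy
  have hxn : 0 < x (last n) := hKH hx
  have hyn : 0 < y (last n) := hy
  have hd : 0 < ‖x - y‖ := norm_pos_iff.2 (sub_ne_zero.2 hxy)
  have hv : |v (last n)| ≤ ‖v‖ := by
    simpa using PiLp.norm_apply_le v (last n)
  have h1 : |sinhSqDeriv x y v| ≤ ‖x - y‖ *
      (((2 * x (last n) * y (last n))⁻¹ + ‖x - y‖ / (4 * x (last n) * y (last n) ^ 2)) * ‖v‖) := by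
    rw [sinhSqDeriv_apply]
    calc _ ≤ |-(2 * x (last n) * y (last n))⁻¹ * ⟪x - y, v⟫|
          + |sinhSq x y / y (last n) * v (last n)| := abs_sub _ _
      _ ≤ (2 * x (last n) * y (last n))⁻¹ * (‖x - y‖ * ‖v‖) + sinhSq x y / y (last n) * ‖v‖ := by
        rw [abs_mul, abs_mul, abs_neg, abs_of_nonneg (by positivity : 0 ≤ (2 * x (last n) *
          y (last n))⁻¹), abs_of_nonneg (div_nonneg (sinhSq_nonneg (hKH hx) hy) hyn.le)]
        have := sinhSq_nonneg (hKH hx) hy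
        gcongr
        exact abs_real_inner_le_norm _ _
      _ = _ := by rw [sinhSq]; field_simp
  have h2 : |greenProfileDeriv n (sinhSq x y)| = 1 / 2 * (4 * x (last n) * y (last n) /
      ‖x - reflect n y‖) ^ n * (‖x - y‖⁻¹ ^ (n - 1) * ‖x - y‖⁻¹) := by
    rw [greenProfileDeriv, hs, abs_mul, abs_of_nonneg (by positivity : 0 ≤ (‖x - y‖ *
      (‖x - reflect n y‖ / (4 * x (last n) * y (last n))))⁻¹ ^ n), ← pow_succ,
      Nat.sub_add_cancel (by omega), mul_assoc (1 / 2 : ℝ), ← mul_pow]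
    congr 1
    · norm_num
    · congr 1
      field_simp
  rw [norm_mul, Real.norm_eq_abs, Real.norm_eq_abs, h2]
  calc _ ≤ 1 / 2 * (4 * x (last n) * y (last n) /
      ‖x - reflect n y‖) ^ n * (‖x - y‖⁻¹ ^ (n - 1) * ‖x - y‖⁻¹) * (‖x - y‖ * (((2 * x (last n) *
          y (last n))⁻¹ + ‖x - y‖ / (4 * x (last n) * y (last n) ^ 2)) * ‖v‖)) := by gcongr
    _ = _ := by field_simp

end Integrability

/-! ### Regularized Green potentials -/

section Potential

theorem integral_comp_smul_add {n : ℕ} {F : Type*} [NormedAddCommGroup F] [NormedSpace ℝ F]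
    (f : E n → F) {a : ℝ} (ha : 0 < a) (b : E n) :
    ∫ x, f x = a ^ n • ∫ w, f (a • w + b) := by
  rw [Measure.integral_comp_smul (μ := volume) (fun w => f (w + b)) a,
    integral_add_right_eq_self f b, smul_smul]
  simp only [finrank_euclideanSpace, Fintype.card_fin]
  rw [abs_of_pos (by positivity), mul_inv_cancel₀ (by positivity), one_smul]

variable {n : ℕ} [NeZero n] {F : Type*} [NormedAddCommGroup F] [NormedSpace ℝ F]

/-- The potential of `ψ` for the kernel `greenProfile n (sinhSq x y + ε)`; for `ε = 0` this is the
hyperbolic Green potential. -/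
def greenPotential (ε : ℝ) (ψ : E n → F) (y : E n) : F :=
  ∫ x in halfSpace n, (x (last n) ^ (n - 2))⁻¹ • (greenProfile n (sinhSq x y + ε) • ψ x)

/-- The similarity of upper half space which maps `e_n` to `y`. -/
def similarity (y w : E n) : E n := y (last n) • w + (y - y (last n) • stdVec (last n))

theorem similarity_apply_last (y w : E n) :
    similarity y w (last n) = y (last n) * w (last n) := by
  simp [similarity, stdVec_apply_last]

/-- A dilation followed by a horizontal translation is a hyperbolic isometry, here carrying `e_n` to
`y`. -/
theorem sinhSq_similarity {y w : E n} (hy : y ∈ halfSpace n) :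
    sinhSq (similarity y w) y = sinhSq w (stdVec (last n)) := by
  have hy : 0 < y (last n) := hy
  have h : similarity y w - y = y (last n) • (w - stdVec (last n)) := by
    rw [similarity]; module
  rw [sinhSq, sinhSq, h, similarity_apply_last, norm_smul, stdVec_apply_last, if_pos rfl,
    Real.norm_of_nonneg hy.le]
  by_cases hw : w (last n) = 0
  · simp [hw]
  · field_simp

theorem stdVec_last_mem : (stdVec (last n) : E n) ∈ halfSpace n := by
  simp [halfSpace, stdVec_apply_last]

/-- The density `ψ` transported by the similarity which maps `e_n` to `y`. -/
def transported (ψ : E n → F) (y w : E n) : F :=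
  (y (last n) ^ 2 * (w (last n) ^ (n - 2))⁻¹) • ψ (similarity y w)

theorem contDiffOn_transported {ψ : E n → F} (hψ : ContDiff ℝ ∞ ψ) :
    ContDiffOn ℝ ∞ (fun p : E n × E n => transported ψ p.1 p.2)
      (halfSpace n ×ˢ halfSpace n) := by
  have h (j : Fin n) : ContDiff ℝ ∞ (fun x : E n => x j) :=
    (EuclideanSpace.proj (𝕜 := ℝ) j).contDiff
  have h1 : ContDiff ℝ ∞ (fun p : E n × E n => p.1 (last n)) := (h _).comp contDiff_fst
  have h2 : ContDiff ℝ ∞ (fun p : E n × E n => p.2 (last n)) := (h _).comp contDiff_snd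
  unfold transported similarity
  refine ContDiffOn.smul ((h1.pow 2).contDiffOn.mul (((h2.pow _).contDiffOn).inv fun p hp => ?_)) ?_
  · have : 0 < p.2 (last n) := hp.2
    positivity
  · exact (hψ.comp ((h1.smul contDiff_snd).add
      (contDiff_fst.sub (h1.smul contDiff_const)))).contDiffOn

theorem greenPotential_eq_integral {ψ : E n → F} (hsupp : tsupport ψ ⊆ halfSpace n) (ε : ℝ)
    (y : E n) : greenPotential ε ψ y =
      ∫ x, (x (last n) ^ (n - 2))⁻¹ • (greenProfile n (sinhSq x y + ε) • ψ x) := by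
  refine setIntegral_eq_integral_of_forall_compl_eq_zero fun x hx => ?_
  rw [image_eq_zero_of_notMem_tsupport fun h => hx (hsupp h), smul_zero, smul_zero]

/-- After this substitution the kernel no longer involves `y`. The Jacobian `y_n^n` and the measure
weight `y_n^(-(n-2))` leave the `y_n²` of `transported`. -/
theorem greenPotential_eq_integral_transported (hn : 2 ≤ n) {ψ : E n → F}
    (hsupp : tsupport ψ ⊆ halfSpace n) (ε : ℝ) {y : E n} (hy : y ∈ halfSpace n) :
    greenPotential ε ψ y =
      ∫ w, greenProfile n (sinhSq w (stdVec (last n)) + ε) • transported ψ y w := by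
  have hyn : 0 < y (last n) := hy
  rw [greenPotential_eq_integral hsupp, integral_comp_smul_add _ hyn
    (y - y (last n) • stdVec (last n)), ← integral_smul]
  refine integral_congr_ae (.of_forall fun w => ?_)
  change y (last n) ^ n • ((similarity y w (last n) ^ (n - 2))⁻¹ •
    (greenProfile n (sinhSq (similarity y w) y + ε) • ψ (similarity y w))) =
    greenProfile n (sinhSq w (stdVec (last n)) + ε) • transported ψ y w
  rw [sinhSq_similarity hy, similarity_apply_last, transported, smul_smul, smul_smul, smul_smul]
  congr 1
  obtain ⟨m, rfl⟩ := Nat.exists_eq_add_of_le' hn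
  simp only [Nat.add_sub_cancel]
  rw [mul_pow, mul_inv, pow_add]
  field_simp

theorem exists_greenPotential_eq_setIntegral (hn : 2 ≤ n) {ψ : E n → F}
    (hcompact : HasCompactSupport ψ) (hsupp : tsupport ψ ⊆ halfSpace n) {y₀ : E n}
    (hy₀ : y₀ ∈ halfSpace n) :
    ∃ U : Set (E n), IsOpen U ∧ y₀ ∈ U ∧ U ⊆ halfSpace n ∧ ∃ K : Set (E n), IsCompact K ∧
      K ⊆ halfSpace n ∧ ∀ ε, ∀ y ∈ U, greenPotential ε ψ y =
        ∫ w in K, greenProfile n (sinhSq w (stdVec (last n)) + ε) • transported ψ y w := by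
  obtain ⟨r, hr, hrH⟩ := Metric.nhds_basis_closedBall.mem_iff.1 (isOpen_halfSpace.mem_nhds hy₀)
  -- `T (y, ·)` is the inverse of `similarity y`. Its image of ball times support is one compact set
  -- that works for all `y` near `y₀`.
  let T : E n × E n → E n := fun p =>
    (p.1 (last n))⁻¹ • (p.2 - p.1) + stdVec (last n)
  have hT : ContinuousOn T (Metric.closedBall y₀ r ×ˢ tsupport ψ) := by
    have h : ContinuousOn (fun p : E n × E n => (p.1 (last n))⁻¹)
        (Metric.closedBall y₀ r ×ˢ tsupport ψ) :=
      ContinuousOn.inv₀ (by fun_prop) fun p hp => ne_of_gt (hrH hp.1)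
    exact (h.smul (by fun_prop)).add continuousOn_const
  refine ⟨Metric.ball y₀ r, Metric.isOpen_ball, Metric.mem_ball_self hr,
    Metric.ball_subset_closedBall.trans hrH, T '' (Metric.closedBall y₀ r ×ˢ tsupport ψ),
    ((isCompact_closedBall y₀ r).prod hcompact).image_of_continuousOn hT, ?_, fun ε y hy => ?_⟩
  · rintro _ ⟨⟨y, x⟩, ⟨hy, hx⟩, rfl⟩
    have h1 : 0 < y (last n) := hrH hy
    have h2 : 0 < x (last n) := hsupp hx
    have h3 : T (y, x) (last n) = x (last n) / y (last n) := by
      simp [T, stdVec_apply_last]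
      field_simp
      ring
    change 0 < T (y, x) (last n)
    rw [h3]
    positivity
  · have hyH := hrH (Metric.ball_subset_closedBall hy)
    rw [greenPotential_eq_integral_transported hn hsupp ε hyH]
    refine (setIntegral_eq_integral_of_forall_compl_eq_zero fun w hw => ?_).symm
    have : similarity y w ∉ tsupport ψ := fun h => hw
      ⟨(y, similarity y w), ⟨Metric.ball_subset_closedBall hy, h⟩, by
        have : y (last n) ≠ 0 := ne_of_gt hyH
        simp only [T, similarity]
        rw [show y (last n) • w + (y - y (last n) • stdVec (last n)) - y =
          y (last n) • (w - stdVec (last n)) by module, smul_smul, inv_mul_cancel₀ this]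
        module⟩
    rw [transported, image_eq_zero_of_notMem_tsupport this, smul_zero, smul_zero]

variable {ψ : E n → F}

theorem contDiffOn_greenPotential (hn : 2 ≤ n) (hψ : ContDiff ℝ ∞ ψ)
    (hcompact : HasCompactSupport ψ) (hsupp : tsupport ψ ⊆ halfSpace n) {ε : ℝ} (hε : 0 ≤ ε) :
    ContDiffOn ℝ 2 (greenPotential ε ψ) (halfSpace n) := by
  intro y₀ hy₀
  obtain ⟨U, hU, hyU, hUH, K, hK, hKH, h⟩ :=
    exists_greenPotential_eq_setIntegral hn hcompact hsupp hy₀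
  have h1 := contDiffOn_setIntegral_smul hU isOpen_halfSpace hK hKH
    (integrableOn_greenProfile hn hK hKH stdVec_last_mem hε)
    (((contDiffOn_transported hψ).of_le ENat.LEInfty.out).mono (prod_mono hUH subset_rfl))
  exact ((h1.congr (h ε)).contDiffAt (hU.mem_nhds hyU)).contDiffWithinAt

theorem ae_tendsto_greenProfile (hn : 2 ≤ n) {K : Set (E n)} (hK : IsCompact K)
    (hKH : K ⊆ halfSpace n) {y : E n} (hy : y ∈ halfSpace n) :
    ∀ᵐ x ∂volume.restrict K, Tendsto (fun ε => greenProfile n (sinhSq x y + ε)) (𝓝[>] 0)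
      (𝓝 (greenProfile n (sinhSq x y + 0))) := by
  filter_upwards [ae_restrict_ne y, ae_restrict_mem hK.measurableSet] with x hxy hx
  have h1 := (hasDerivAt_greenProfile hn (q := sinhSq x y + 0)
    (by simpa using sinhSq_pos (hKH hx) hy hxy)).continuousAt.tendsto
  refine h1.comp (tendsto_const_nhds.add (tendsto_nhdsWithin_of_tendsto_nhds tendsto_id))

/-- In the transported form `ε` enters only the integrable weight and the derivatives fall on the
density, so dominated convergence applies to both orders. -/
theorem tendsto_fderiv_greenPotential (hn : 2 ≤ n) (hψ : ContDiff ℝ ∞ ψ)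
    (hcompact : HasCompactSupport ψ) (hsupp : tsupport ψ ⊆ halfSpace n) {y : E n}
    (hy : y ∈ halfSpace n) :
    Tendsto (fun ε => fderiv ℝ (greenPotential ε ψ) y) (𝓝[>] 0)
        (𝓝 (fderiv ℝ (greenPotential 0 ψ) y)) ∧
      Tendsto (fun ε => fderiv ℝ (fderiv ℝ (greenPotential ε ψ)) y) (𝓝[>] 0)
        (𝓝 (fderiv ℝ (fderiv ℝ (greenPotential 0 ψ)) y)) := by
  obtain ⟨U, hU, hyU, hUH, K, hK, hKH, h⟩ :=
    exists_greenPotential_eq_setIntegral hn hcompact hsupp hy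
  have hΨ := (contDiffOn_transported hψ).mono
    (prod_mono_left (t := halfSpace n) hUH)
  have heq : ∀ ε, greenPotential ε ψ =ᶠ[𝓝 y] fun y =>
      ∫ w in K, greenProfile n (sinhSq w (stdVec (last n)) + ε) • transported ψ y w := fun ε => by
    filter_upwards [hU.mem_nhds hyU] with z hz using h ε z hz
  have h1 : ∀ ε, 0 ≤ ε → fderiv ℝ (greenPotential ε ψ) y =
      ∫ w in K, greenProfile n (sinhSq w (stdVec (last n)) + ε) •
        fderiv ℝ (fun z => transported ψ z w) y := fun ε hε => by
    rw [(heq ε).fderiv_eq]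
    exact (hasFDerivAt_setIntegral_smul hU isOpen_halfSpace hK hKH
      (integrableOn_greenProfile hn hK hKH stdVec_last_mem hε)
      (hΨ.of_le ENat.LEInfty.out) hyU).fderiv
  have h2 : ∀ ε, 0 ≤ ε → fderiv ℝ (fderiv ℝ (greenPotential ε ψ)) y =
      ∫ w in K, greenProfile n (sinhSq w (stdVec (last n)) + ε) •
        fderiv ℝ (fderiv ℝ (fun z => transported ψ z w)) y := fun ε hε => by
    rw [(heq ε).fderiv.fderiv_eq]
    exact fderiv_fderiv_setIntegral_smul hU isOpen_halfSpace hK hKH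
      (integrableOn_greenProfile hn hK hKH stdVec_last_mem hε)
      (hΨ.of_le ENat.LEInfty.out) hyU
  have hD1 : ContDiffOn ℝ 1 (fun p : E n × E n => fderiv ℝ (fun z => transported ψ z p.2) p.1)
      (U ×ˢ halfSpace n) :=
    contDiffOn_fderiv_left (m := 1) hU isOpen_halfSpace
      (hΨ.of_le (by norm_num; exact ENat.LEInfty.out))
  have hD2 : ContDiffOn ℝ 0 (fun p : E n × E n =>
      fderiv ℝ (fun z => fderiv ℝ (fun z => transported ψ z p.2) z) p.1) (U ×ˢ halfSpace n) :=
    contDiffOn_fderiv_left (Ψ := fun y w => fderiv ℝ (fun z => transported ψ z w) y)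
      (m := 0) hU isOpen_halfSpace (by simpa using hD1)
  have hmem : ∀ᶠ ε : ℝ in 𝓝[>] 0, 0 ≤ ε := by
    filter_upwards [self_mem_nhdsWithin] with ε hε using le_of_lt hε
  -- The target space is left general because the first and second derivatives take values in
  -- different spaces of linear maps.
  have key : ∀ {G : Type _} [NormedAddCommGroup G] [NormedSpace ℝ G] {Φ : E n → G},
      ContinuousOn Φ K → Tendsto (fun ε => ∫ w in K,
        greenProfile n (sinhSq w (stdVec (last n)) + ε) • Φ w) (𝓝[>] 0)
        (𝓝 (∫ w in K, greenProfile n (sinhSq w (stdVec (last n)) + 0) • Φ w)) := by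
    intro G _ _ Φ hΦ
    refine tendsto_setIntegral_smul hK ?_
      (integrableOn_greenProfile_bound hK hKH stdVec_last_mem) ?_
      (ae_tendsto_greenProfile hn hK hKH stdVec_last_mem) hΦ
    · filter_upwards [hmem] with ε hε
      exact aestronglyMeasurable_greenProfile hn hK hKH stdVec_last_mem hε
    · filter_upwards [hmem] with ε hε
      exact ae_abs_greenProfile_le hK hKH stdVec_last_mem hε
  constructor
  · rw [h1 0 le_rfl]
    refine (key (continuousOn_right (Ψ := fun y w => fderiv ℝ (fun z => transported ψ z w) y)
      hD1.continuousOn hyU hKH)).congr' ?_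
    filter_upwards [hmem] with ε hε using (h1 ε hε).symm
  · rw [h2 0 le_rfl]
    refine (key (continuousOn_right
      (Ψ := fun y w => fderiv ℝ (fun z => fderiv ℝ (fun z => transported ψ z w) z) y)
      hD2.continuousOn hyU hKH)).congr' ?_
    filter_upwards [hmem] with ε hε using (h2 ε hε).symm

theorem tendsto_hypLap_greenPotential (hn : 2 ≤ n) (hψ : ContDiff ℝ ∞ ψ)
    (hcompact : HasCompactSupport ψ) (hsupp : tsupport ψ ⊆ halfSpace n) {y : E n}
    (hy : y ∈ halfSpace n) :
    Tendsto (fun ε => hypLap (greenPotential ε ψ) y) (𝓝[>] 0)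
      (𝓝 (hypLap (greenPotential 0 ψ) y)) := by
  obtain ⟨h1, h2⟩ := tendsto_fderiv_greenPotential hn hψ hcompact hsupp hy
  refine Tendsto.sub (tendsto_finsetSum _ fun j _ => ?_) (Tendsto.const_smul ?_ _)
  · exact ((ContinuousLinearMap.apply ℝ F (stdVec j)).continuous.tendsto _).comp
      (((ContinuousLinearMap.apply ℝ (E n →L[ℝ] F) (stdVec j)).continuous.tendsto _).comp h2)
  · exact ((ContinuousLinearMap.apply ℝ F (stdVec (last n))).continuous.tendsto _).comp h1

end Potential

/-! ### The regularized kernels are an approximate identity -/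

section ApproximateIdentity

/-- This antiderivative of the radial density of the limiting kernel rises from `0` to `1` on the
half line when `n > 0`, which fixes the mass of the approximate identity. -/
theorem hasDerivAt_div_sqrt_pow (n : ℕ) (t : ℝ) :
    HasDerivAt (fun t : ℝ => (t * (√(1 + t ^ 2))⁻¹) ^ n)
      (n * (t ^ (n - 1) * (√(1 + t ^ 2))⁻¹ ^ (n + 2))) t := by
  have hR : 0 < 1 + t ^ 2 := by positivity
  have hs := Real.sqrt_pos.2 hR
  have hsq := Real.sq_sqrt hR.le
  have h1 : HasDerivAt (fun t : ℝ => 1 + t ^ 2) (2 * t) t := by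
    refine (((hasDerivAt_id t).pow 2).const_add 1).congr_deriv ?_
    simp
  have h2 := ((hasDerivAt_id t).mul ((h1.sqrt hR.ne').inv hs.ne')).pow n
  refine h2.congr_deriv ?_
  set s := √(1 + t ^ 2)
  have h3 : 1 * s⁻¹ + t * (-(2 * t / (2 * s)) / s ^ 2) = s⁻¹ ^ 3 := by
    field_simp
    rw [hsq]; ring
  have h4 : ∀ m : ℕ, n = m → s⁻¹ ^ (m - 1) * s⁻¹ ^ 3 * n = n * s⁻¹ ^ (n + 2) := by
    rintro m rfl
    rcases n with _ | n
    · simp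
    · simp only [Nat.add_sub_cancel]; ring
  simp only [Pi.mul_apply, Pi.inv_apply, id]
  rw [h3, mul_pow]
  linear_combination t ^ (n - 1) * h4 n rfl

theorem tendsto_div_sqrt_pow (n : ℕ) :
    Tendsto (fun t : ℝ => (t * (√(1 + t ^ 2))⁻¹) ^ n) atTop (𝓝 1) := by
  have h1 : Tendsto (fun t : ℝ => (√((t ^ 2)⁻¹ + 1))⁻¹) atTop (𝓝 1) := by
    have h : Tendsto (fun t : ℝ => (t ^ 2)⁻¹ + 1) atTop (𝓝 (0 + 1)) :=
      (tendsto_pow_atTop (α := ℝ) two_ne_zero).inv_tendsto_atTop.add_const 1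
    have := (h.sqrt).inv₀ (by simp)
    simpa using this
  have h2 : Tendsto (fun t : ℝ => t * (√(1 + t ^ 2))⁻¹) atTop (𝓝 1) := by
    refine h1.congr' ?_
    filter_upwards [eventually_gt_atTop 0] with t ht
    have : 1 + t ^ 2 = t ^ 2 * ((t ^ 2)⁻¹ + 1) := by field_simp
    rw [this, Real.sqrt_mul (by positivity), Real.sqrt_sq ht.le, mul_inv, ← mul_assoc,
      mul_inv_cancel₀ ht.ne', one_mul]
  simpa using h2.pow n

theorem integrableOn_radial {n : ℕ} :
    IntegrableOn (fun t : ℝ => n * (t ^ (n - 1) * (√(1 + t ^ 2))⁻¹ ^ (n + 2))) (Ioi 0) :=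
  integrableOn_Ioi_deriv_of_nonneg' (fun t _ => hasDerivAt_div_sqrt_pow n t)
    (fun t (ht : 0 < t) => by positivity) (tendsto_div_sqrt_pow n)

/-- `approxKernel` after rescaling by `δ = √ε`. -/
def rescaledKernel (n : ℕ) (δ p : ℝ) : ℝ :=
  -(n / 4 * (1 + δ ^ 2 * p + δ ^ 2 * (p + 1) + 2 * (δ ^ 2 * p) * (δ ^ 2 * (p + 1))) *
    (√((1 + p) * (1 + δ ^ 2 * (p + 1))))⁻¹ ^ (n + 2))

/-- The factor `δ^n` is the Jacobian of the rescaling; together with `ε = δ²` it balances the power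
`δ^(-(n+2))` of the kernel. -/
theorem pow_mul_approxKernel (n : ℕ) {δ p : ℝ} (hδ : 0 < δ) :
    δ ^ n * approxKernel n (δ ^ 2) (δ ^ 2 * p) = rescaledKernel n δ p := by
  have h : √((δ ^ 2 * p + δ ^ 2) * (1 + (δ ^ 2 * p + δ ^ 2))) =
      δ * √((1 + p) * (1 + δ ^ 2 * (p + 1))) := by
    rw [show (δ ^ 2 * p + δ ^ 2) * (1 + (δ ^ 2 * p + δ ^ 2)) =
      δ ^ 2 * ((1 + p) * (1 + δ ^ 2 * (p + 1))) by ring, Real.sqrt_mul (by positivity),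
      Real.sqrt_sq hδ.le]
  rw [approxKernel, rescaledKernel, h, mul_inv, mul_pow δ⁻¹]
  have h2 : δ ^ n * δ ^ 2 * δ⁻¹ ^ (n + 2) = 1 := by
    rw [← pow_add, ← mul_pow, mul_inv_cancel₀ hδ.ne', one_pow]
  linear_combination (-(n / 4 * (1 + δ ^ 2 * p + δ ^ 2 * (p + 1) + 2 * (δ ^ 2 * p) * (δ ^ 2 * (p + 1)))
    * (√((1 + p) * (1 + δ ^ 2 * (p + 1))))⁻¹ ^ (n + 2))) * h2

/-- The polynomial factor is at most `2(1+r)²`, which `(1+r)^((n+2)/2)` absorbs since `n + 2 ≥ 4`.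
The bound is therefore free of `δ`. -/
theorem abs_rescaledKernel_le {n : ℕ} (hn : 2 ≤ n) {δ p : ℝ} (hp : 0 ≤ p) :
    |rescaledKernel n δ p| ≤ n / 2 * (√(1 + p))⁻¹ ^ (n + 2) := by
  set r := δ ^ 2 * (p + 1) with hr
  have hr0 : 0 ≤ r := by positivity
  have hq0 : 0 ≤ δ ^ 2 * p := by positivity
  have hqr : δ ^ 2 * p ≤ r := by rw [hr]; nlinarith [sq_nonneg δ]
  have hs : 1 ≤ √(1 + r) := Real.one_le_sqrt.2 (by linarith)
  have hb : 1 + δ ^ 2 * p + r + 2 * (δ ^ 2 * p) * r ≤ 2 * √(1 + r) ^ (n + 2) := by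
    have h4 : √(1 + r) ^ 4 = (1 + r) ^ 2 := by
      rw [show √(1 + r) ^ 4 = (√(1 + r) ^ 2) ^ 2 by ring, Real.sq_sqrt (by linarith)]
    calc _ ≤ 2 * (1 + r) ^ 2 := by nlinarith [mul_le_mul_of_nonneg_right hqr hr0]
      _ = 2 * √(1 + r) ^ 4 := by rw [h4]
      _ ≤ 2 * √(1 + r) ^ (n + 2) := by gcongr; omega
  rw [rescaledKernel, ← hr, abs_neg, Real.sqrt_mul (by positivity), mul_inv, mul_pow,
    abs_of_nonneg (by positivity)]
  have hs0 : 0 < √(1 + r) := by linarith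
  calc _ ≤ n / 4 * (2 * √(1 + r) ^ (n + 2)) * ((√(1 + p))⁻¹ ^ (n + 2) *
        (√(1 + r))⁻¹ ^ (n + 2)) := by gcongr
    _ = _ := by rw [inv_pow √(1 + r)]; field_simp; ring

variable {n : ℕ} [NeZero n]

theorem integral_radial :
    ∫ t in Ioi (0 : ℝ), n * (t ^ (n - 1) * (√(1 + t ^ 2))⁻¹ ^ (n + 2)) = 1 := by
  rw [integral_Ioi_of_hasDerivAt_of_nonneg' (fun t _ => hasDerivAt_div_sqrt_pow n t)
    (fun t (ht : 0 < t) => by positivity) (tendsto_div_sqrt_pow n)]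
  simp [NeZero.ne n]

theorem integrable_inv_sqrt_one_add_norm_sq :
    Integrable (fun z : E n => (√(1 + ‖z‖ ^ 2))⁻¹ ^ (n + 2)) := by
  have := nontrivial_E (n := n)
  rw [integrable_fun_norm_addHaar volume (f := fun t => (√(1 + t ^ 2))⁻¹ ^ (n + 2))]
  have h := (integrableOn_radial (n := n)).const_mul (n : ℝ)⁻¹
  refine IntegrableOn.congr_fun h (fun t _ => ?_) measurableSet_Ioi
  have : (n : ℝ) ≠ 0 := Nat.cast_ne_zero.2 (NeZero.ne n)
  simp only [finrank_euclideanSpace, Fintype.card_fin, smul_eq_mul]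
  field_simp

/-- In polar coordinates the radial integral is `1/n`, and the angular factor `n · vol(B)` is `ω_n`.
-/
theorem integral_inv_sqrt_one_add_norm_sq :
    n * ∫ z : E n, (√(1 + ‖z‖ ^ 2))⁻¹ ^ (n + 2) = sphereArea n := by
  have := nontrivial_E (n := n)
  rw [integral_fun_norm_addHaar volume (fun t => (√(1 + t ^ 2))⁻¹ ^ (n + 2)), sphereArea,
    Measure.toSphere_real_apply_univ]
  have h := integral_radial (n := n)
  rw [integral_const_mul] at h
  simp only [finrank_euclideanSpace, Fintype.card_fin, smul_eq_mul, nsmul_eq_mul]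
  linear_combination (n * volume.real (Metric.ball (0 : E n) 1)) * h

/-- The scale `2 y_n δ` is chosen so that `q/δ²` tends to `‖z‖²`. -/
theorem sinhSq_smul_add {y : E n} (hy : y ∈ halfSpace n) (δ : ℝ) (z : E n) :
    sinhSq ((2 * y (last n) * δ) • z + y) y = δ ^ 2 * (‖z‖ ^ 2 / (1 + 2 * δ * z (last n))) := by
  have hy : 0 < y (last n) := hy
  rw [sinhSq, add_sub_cancel_right, norm_smul, mul_pow, Real.norm_eq_abs, sq_abs]
  have : ((2 * y (last n) * δ) • z + y) (last n) = y (last n) * (1 + 2 * δ * z (last n)) := by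
    simp; ring
  rw [this]
  by_cases h : 1 + 2 * δ * z (last n) = 0
  · simp [h]
  · field_simp
    ring

variable {F : Type*} [NormedAddCommGroup F] [NormedSpace ℝ F] [CompleteSpace F]

/-- Substituting `x = y + 2 y_n δ z` turns the kernel into `rescaledKernel`, which converges to
`-(n/4)(1+‖z‖²)^(-(n+2)/2)` while `Θ` converges to its value at `y`. The factor `(2 y_n)^n` is what
remains of the Jacobian. -/
theorem tendsto_integral_approxKernel (hn : 2 ≤ n) {Θ : E n → F} (hΘ : Continuous Θ)
    (hcompact : HasCompactSupport Θ) (hsupp : tsupport Θ ⊆ halfSpace n) {y : E n}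
    (hy : y ∈ halfSpace n) :
    Tendsto (fun δ : ℝ => ∫ x, approxKernel n (δ ^ 2) (sinhSq x y) • Θ x) (𝓝[>] 0)
      (𝓝 ((-((2 * y (last n)) ^ n * (sphereArea n / 4))) • Θ y)) := by
  have hyn : 0 < y (last n) := hy
  have hres : ∀ δ : ℝ, 0 < δ → ∫ x, approxKernel n (δ ^ 2) (sinhSq x y) • Θ x =
      (2 * y (last n)) ^ n • ∫ z : E n,
        rescaledKernel n δ (‖z‖ ^ 2 / (1 + 2 * δ * z (last n))) •
          Θ ((2 * y (last n) * δ) • z + y) := by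
    intro δ hδ
    rw [integral_comp_smul_add _ (by positivity : 0 < 2 * y (last n) * δ) y, mul_pow, mul_smul,
      ← integral_smul]
    congr 2
    ext z
    rw [smul_smul, sinhSq_smul_add hy, pow_mul_approxKernel n hδ]
  obtain ⟨C, hC⟩ := hcompact.exists_bound_of_continuous hΘ
  obtain ⟨R, hR⟩ : ∃ R, ∀ x ∈ tsupport Θ, ‖x (last n)‖ ≤ R :=
    IsCompact.exists_bound_of_continuousOn hcompact (f := fun x : E n => x (last n)) (by fun_prop)
  -- `W` bounds `x_n / y_n` on the support; being at least `1`, it also absorbs the summand `1`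
  -- under the square root.
  set W := max 1 (R / y (last n)) with hW
  have hW1 : 1 ≤ W := le_max_left _ _
  have hlim : Tendsto (fun δ : ℝ => ∫ z : E n,
        rescaledKernel n δ (‖z‖ ^ 2 / (1 + 2 * δ * z (last n))) •
          Θ ((2 * y (last n) * δ) • z + y)) (𝓝[>] 0)
      (𝓝 (∫ z : E n, (-(n / 4 * (√(1 + ‖z‖ ^ 2))⁻¹ ^ (n + 2))) • Θ y)) := by
    refine tendsto_integral_filter_of_dominated_convergence
      (fun z => (n / 2 * (√W * (√(1 + ‖z‖ ^ 2))⁻¹) ^ (n + 2)) * C) ?_ ?_ ?_ ?_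
    · refine .of_forall fun δ => AEStronglyMeasurable.smul (Measurable.aestronglyMeasurable ?_) ?_
      · have h1 : Measurable (fun z : E n => ‖z‖ ^ 2 / (1 + 2 * δ * z (last n))) :=
          Measurable.div (by fun_prop) (by fun_prop)
        have h2 : Measurable (rescaledKernel n δ) := by unfold rescaledKernel; fun_prop
        exact h2.comp h1
      · exact (hΘ.comp (by fun_prop)).aestronglyMeasurable
    · filter_upwards [self_mem_nhdsWithin] with δ hδ
      have hδ : 0 < δ := hδ
      refine .of_forall fun z => ?_
      rw [norm_smul, Real.norm_eq_abs]
      set x := (2 * y (last n) * δ) • z + y with hx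
      -- The denominator `1 + 2δ z_n = x_n / y_n` may vanish or be negative for general `z`, but on
      -- the support it lies in `(0, W]`, and elsewhere the integrand is zero.
      by_cases hxs : x ∈ tsupport Θ
      · have hxn : 0 < x (last n) := hsupp hxs
        have hm : x (last n) = y (last n) * (1 + 2 * δ * z (last n)) := by
          simp [hx]; ring
        set m := 1 + 2 * δ * z (last n) with hm_def
        have hm0 : 0 < m := by rw [hm] at hxn; exact pos_of_mul_pos_right hxn hyn.le
        have hmW : m ≤ W := by
          refine le_max_of_le_right ?_
          rw [le_div_iff₀ hyn, mul_comm, ← hm]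
          exact (le_abs_self _).trans (hR x hxs)
        refine mul_le_mul ((abs_rescaledKernel_le hn (by positivity)).trans ?_) (hC x)
          (norm_nonneg _) (by positivity)
        have h1 : (√(1 + ‖z‖ ^ 2 / m))⁻¹ ≤ √W * (√(1 + ‖z‖ ^ 2))⁻¹ := by
          rw [← div_eq_mul_inv, ← Real.sqrt_div (by positivity), ← Real.sqrt_inv]
          refine Real.sqrt_le_sqrt ?_
          rw [← one_div, div_le_div_iff₀ (by positivity) (by positivity)]
          have : ‖z‖ ^ 2 ≤ W * (‖z‖ ^ 2 / m) := by
            rw [← mul_div_assoc, le_div_iff₀ hm0, mul_comm]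
            gcongr
          nlinarith
        gcongr
      · rw [image_eq_zero_of_notMem_tsupport hxs, norm_zero, mul_zero]
        have := (norm_nonneg _).trans (hC 0)
        positivity
    · have h := (integrable_inv_sqrt_one_add_norm_sq (n := n)).const_mul (n / 2 * √W ^ (n + 2))
      refine Integrable.mul_const (h.congr (.of_forall fun z => ?_)) C
      simp only
      rw [mul_pow]; ring
    · refine .of_forall fun z => Tendsto.smul ?_ ?_
      · have h1 : Tendsto (fun δ : ℝ => ‖z‖ ^ 2 / (1 + 2 * δ * z (last n))) (𝓝 0)
            (𝓝 (‖z‖ ^ 2)) := by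
          have : ContinuousAt (fun δ : ℝ => ‖z‖ ^ 2 / (1 + 2 * δ * z (last n))) 0 :=
            ContinuousAt.div (by fun_prop) (by fun_prop) (by simp)
          simpa using this.tendsto
        have h2 : ContinuousAt (fun u : ℝ × ℝ => rescaledKernel n u.1 u.2) (0, ‖z‖ ^ 2) := by
          unfold rescaledKernel
          refine ((ContinuousAt.mul (by fun_prop) (ContinuousAt.pow (ContinuousAt.inv₀
            (by fun_prop) ?_) _))).neg
          exact (Real.sqrt_pos.2 (by simp; positivity)).ne'
        have h3 := h2.tendsto.comp (tendsto_id.prodMk_nhds h1)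
        refine Tendsto.mono_left ?_ nhdsWithin_le_nhds
        simpa [rescaledKernel, Function.comp_def] using h3
      · have h1 : Continuous (fun δ : ℝ => Θ ((2 * y (last n) * δ) • z + y)) :=
          hΘ.comp (by fun_prop)
        have h2 := h1.tendsto 0
        simp only [mul_zero, zero_smul, zero_add] at h2
        exact h2.mono_left nhdsWithin_le_nhds
  have hval : (2 * y (last n)) ^ n • ∫ z : E n, (-(n / 4 * (√(1 + ‖z‖ ^ 2))⁻¹ ^ (n + 2))) • Θ y =
      (-((2 * y (last n)) ^ n * (sphereArea n / 4))) • Θ y := by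
    rw [integral_smul_const, integral_neg, integral_const_mul, smul_smul,
      ← integral_inv_sqrt_one_add_norm_sq]
    congr 1
    ring
  rw [← hval]
  refine (hlim.const_smul _).congr' ?_
  filter_upwards [self_mem_nhdsWithin] with δ hδ using (hres δ hδ).symm

end ApproximateIdentity

/-! ### Derivatives of the Green potential -/

section GreenPotential

theorem integrableOn_smul_continuousOn {n : ℕ} {G : Type*} [NormedAddCommGroup G]
    [NormedSpace ℝ G] {K : Set (E n)} {f : E n → ℝ} {Φ : E n → G} (hK : IsCompact K)
    (hf : IntegrableOn f K) (hΦ : ContinuousOn Φ K) : IntegrableOn (fun x => f x • Φ x) K :=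
  hf.smul_continuousOn hΦ hK

variable {n : ℕ} [NeZero n] {F : Type*} [NormedAddCommGroup F]
  {ψ : E n → F}

theorem continuousOn_inv_last_pow :
    ContinuousOn (fun x : E n => (x (last n) ^ (n - 2))⁻¹) (halfSpace n) :=
  ContinuousOn.inv₀ (by fun_prop) fun _ hx => pow_ne_zero _ (ne_of_gt hx)

theorem integrableOn_inv_last_pow (hcompact : HasCompactSupport ψ)
    (hsupp : tsupport ψ ⊆ halfSpace n) :
    IntegrableOn (fun x : E n => (x (last n) ^ (n - 2))⁻¹) (tsupport ψ) :=
  (continuousOn_inv_last_pow.mono hsupp).integrableOn_compact hcompact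

variable [NormedSpace ℝ F]

theorem greenPotential_eq_setIntegral_tsupport (hsupp : tsupport ψ ⊆ halfSpace n)
    (ε : ℝ) : greenPotential ε ψ = fun y =>
      ∫ x in tsupport ψ, (x (last n) ^ (n - 2))⁻¹ • (greenProfile n (sinhSq x y + ε) • ψ x) := by
  ext y
  rw [greenPotential_eq_integral hsupp]
  refine (setIntegral_eq_integral_of_forall_compl_eq_zero fun x hx => ?_).symm
  rw [image_eq_zero_of_notMem_tsupport hx, smul_zero, smul_zero]

theorem contDiffOn_greenProfile_smul (hn : 2 ≤ n) (hψ : ContDiff ℝ ∞ ψ) {ε : ℝ} (hε : 0 < ε) :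
    ContDiffOn ℝ 2 (fun p : E n × E n => greenProfile n (sinhSq p.2 p.1 + ε) • ψ p.2)
      (halfSpace n ×ˢ halfSpace n) :=
  (contDiffOn_greenProfile_sinhSq hn hε).smul
    ((hψ.comp contDiff_snd).of_le ENat.LEInfty.out).contDiffOn

theorem fderiv_greenPotential_regularized (hn : 2 ≤ n) (hψ : ContDiff ℝ ∞ ψ)
    (hcompact : HasCompactSupport ψ) (hsupp : tsupport ψ ⊆ halfSpace n) {ε : ℝ} (hε : 0 < ε)
    {y : E n} (hy : y ∈ halfSpace n) (v : E n) :
    fderiv ℝ (greenPotential ε ψ) y v =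
      ∫ x in tsupport ψ, (greenProfileDeriv n (sinhSq x y + ε) * sinhSqDeriv x y v) •
        ((x (last n) ^ (n - 2))⁻¹ • ψ x) := by
  have hf := integrableOn_inv_last_pow hcompact hsupp
  have hΨ := contDiffOn_greenProfile_smul hn hψ hε
  have hD : ContDiffOn ℝ 1 (fun p : E n × E n => fderiv ℝ (fun z =>
      greenProfile n (sinhSq p.2 z + ε) • ψ p.2) p.1) (halfSpace n ×ˢ halfSpace n) :=
    contDiffOn_fderiv_left (Ψ := fun y x => greenProfile n (sinhSq x y + ε) • ψ x)
      (m := 1) isOpen_halfSpace isOpen_halfSpace hΨ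
  rw [greenPotential_eq_setIntegral_tsupport hsupp, (hasFDerivAt_setIntegral_smul
    (Ψ := fun y x => greenProfile n (sinhSq x y + ε) • ψ x) isOpen_halfSpace
    isOpen_halfSpace hcompact hsupp hf (hΨ.of_le one_le_two) hy).fderiv,
    ContinuousLinearMap.integral_apply (hf.smul_continuousOn (continuousOn_right
    (Ψ := fun y x => fderiv ℝ (fun z => greenProfile n (sinhSq x z + ε) • ψ x) y)
    hD.continuousOn hy hsupp) hcompact)]
  refine setIntegral_congr_fun hcompact.measurableSet fun x hx => ?_
  have h := (hasFDerivAt_greenProfile_sinhSq hn (hsupp hx) hy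
    (add_pos_of_nonneg_of_pos (sinhSq_nonneg (hsupp hx) hy) hε)).smul_const (ψ x)
  simp only [h.fderiv, smul_smul, mul_comm, FunLike.coe_smul, Pi.smul_apply,
    ContinuousLinearMap.smulRight_apply, smul_eq_mul]

theorem hypLap_setIntegral_smul {U V K : Set (E n)} {f : E n → ℝ} {Ψ : E n → E n → F}
    (hU : IsOpen U) (hV : IsOpen V) (hK : IsCompact K)
    (hKV : K ⊆ V) (hf : IntegrableOn f K)
    (hΨ : ContDiffOn ℝ 2 (fun p : E n × E n => Ψ p.1 p.2) (U ×ˢ V)) {y : E n} (hy : y ∈ U) :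
    hypLap (fun y => ∫ w in K, f w • Ψ y w) y = ∫ w in K, f w • hypLap (fun z => Ψ z w) y := by
  have hD1 : ContDiffOn ℝ 1 (fun p : E n × E n => fderiv ℝ (fun z => Ψ z p.2) p.1) (U ×ˢ V) :=
    contDiffOn_fderiv_left (m := 1) hU hV hΨ
  have hD2 : ContDiffOn ℝ 0 (fun p : E n × E n =>
      fderiv ℝ (fun z => fderiv ℝ (fun z => Ψ z p.2) z) p.1) (U ×ˢ V) :=
    contDiffOn_fderiv_left (Ψ := fun y w => fderiv ℝ (fun z => Ψ z w) y)
      (m := 0) hU hV (by simpa using hD1)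
  have i1 := integrableOn_smul_continuousOn hK hf (continuousOn_right
    (Ψ := fun y w => fderiv ℝ (fun z => Ψ z w) y) hD1.continuousOn hy hKV)
  have i2 := integrableOn_smul_continuousOn hK hf (continuousOn_right
    (Ψ := fun y w => fderiv ℝ (fun z => fderiv ℝ (fun z => Ψ z w) z) y)
    hD2.continuousOn hy hKV)
  rw [hypLap, fderiv_fderiv_setIntegral_smul hU hV hK hKV hf hΨ hy,
    (hasFDerivAt_setIntegral_smul hU hV hK hKV hf (hΨ.of_le one_le_two) hy).fderiv,
    ContinuousLinearMap.integral_apply i1]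
  have e2 : ∀ j : Fin n, (∫ w in K, f w • fderiv ℝ (fderiv ℝ fun z => Ψ z w) y) (stdVec j)
      (stdVec j) = ∫ w in K, (f w • fderiv ℝ (fderiv ℝ fun z => Ψ z w) y) (stdVec j)
      (stdVec j) := fun j => by
    rw [ContinuousLinearMap.integral_apply i2,
      ContinuousLinearMap.integral_apply (i2.apply_continuousLinearMap (stdVec j))]
  have i3 : ∀ j : Fin n, IntegrableOn (fun w => (f w • fderiv ℝ (fderiv ℝ fun z => Ψ z w) y)
      (stdVec j) (stdVec j)) K := fun j =>
    (i2.apply_continuousLinearMap (stdVec j)).apply_continuousLinearMap (stdVec j)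
  rw [Finset.sum_congr rfl fun j _ => e2 j, ← integral_finsetSum _ fun j _ => i3 j,
    ← integral_smul]
  refine (integral_sub (integrable_finsetSum _ fun j _ => i3 j)
    ((i1.apply_continuousLinearMap _).smul _)).symm.trans ?_
  refine integral_congr_ae (.of_forall fun w => ?_)
  simp [hypLap, smul_sub, Finset.smul_sum, smul_smul, mul_comm]

theorem hypLap_greenPotential_regularized (hn : 2 ≤ n) (hψ : ContDiff ℝ ∞ ψ)
    (hcompact : HasCompactSupport ψ) (hsupp : tsupport ψ ⊆ halfSpace n) {ε : ℝ} (hε : 0 < ε)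
    {y : E n} (hy : y ∈ halfSpace n) :
    hypLap (greenPotential ε ψ) y = (y (last n) ^ 2)⁻¹ •
      ∫ x, approxKernel n ε (sinhSq x y) • ((x (last n) ^ (n - 2))⁻¹ • ψ x) := by
  rw [greenPotential_eq_setIntegral_tsupport hsupp, hypLap_setIntegral_smul
    (Ψ := fun y x => greenProfile n (sinhSq x y + ε) • ψ x) isOpen_halfSpace
    isOpen_halfSpace hcompact hsupp (integrableOn_inv_last_pow hcompact hsupp)
    (contDiffOn_greenProfile_smul hn hψ hε) hy, ← integral_smul,
    ← setIntegral_eq_integral_of_forall_compl_eq_zero (μ := volume) (s := tsupport ψ)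
      (f := fun x => (y (last n) ^ 2)⁻¹ •
        (approxKernel n ε (sinhSq x y) • ((x (last n) ^ (n - 2))⁻¹ • ψ x))) fun x hx => by
      rw [image_eq_zero_of_notMem_tsupport hx, smul_zero, smul_zero, smul_zero]]
  refine setIntegral_congr_fun hcompact.measurableSet fun x hx => ?_
  simp only
  rw [hypLap_smul_const (contDiffAt_greenProfile_sinhSq hn hε (hsupp hx) hy),
    hypLap_greenProfile_sinhSq hn hε (hsupp hx) hy]
  simp only [smul_smul]
  congr 1
  ring

/-- Differentiation of the Green potential under the integral sign. -/
theorem fderiv_greenPotential (hn : 2 ≤ n) (hψ : ContDiff ℝ ∞ ψ)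
    (hcompact : HasCompactSupport ψ) (hsupp : tsupport ψ ⊆ halfSpace n) {y : E n}
    (hy : y ∈ halfSpace n) (v : E n) :
    fderiv ℝ (greenPotential 0 ψ) y v =
      ∫ x in tsupport ψ, (greenProfileDeriv n (sinhSq x y) * sinhSqDeriv x y v) •
        ((x (last n) ^ (n - 2))⁻¹ • ψ x) := by
  have hmem : ∀ᶠ ε : ℝ in 𝓝[>] 0, 0 < ε := self_mem_nhdsWithin
  have h1 := ((ContinuousLinearMap.apply ℝ F v).continuous.tendsto _).comp
    (tendsto_fderiv_greenPotential hn hψ hcompact hsupp hy).1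
  -- The regularized derivative has two limits: through the transported form, the derivative of the
  -- potential; through the differentiated kernel, the singular integral, dominated by its own
  -- absolute value because `|greenProfileDeriv|` decreases in `ε`.
  refine tendsto_nhds_unique (h1.congr' ?_) (tendsto_setIntegral_smul (l := 𝓝[>] (0 : ℝ)) hcompact
    (fi := fun ε x => greenProfileDeriv n (sinhSq x y + ε) * sinhSqDeriv x y v) ?_
    (integrableOn_greenProfileDeriv hn hcompact hsupp hy v).norm ?_ ?_
    ((continuousOn_inv_last_pow.mono hsupp).smul hψ.continuous.continuousOn))
  · filter_upwards [hmem] with ε hε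
    exact fderiv_greenPotential_regularized hn hψ hcompact hsupp hε hy v
  · filter_upwards [hmem] with ε hε
    exact aestronglyMeasurable_greenProfileDeriv hcompact hsupp hy hε.le v
  · filter_upwards [hmem] with ε hε
    filter_upwards [ae_restrict_ne y, ae_restrict_mem hcompact.measurableSet] with x hxy hx
    rw [Real.norm_eq_abs, abs_mul, abs_mul]
    exact mul_le_mul_of_nonneg_right (abs_greenProfileDeriv_add_le n
      (sinhSq_pos (hsupp hx) hy hxy) hε.le) (abs_nonneg _)
  · filter_upwards [ae_restrict_ne y, ae_restrict_mem hcompact.measurableSet] with x hxy hx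
    have h2 := (hasDerivAt_greenProfileDeriv n (q := sinhSq x y + 0)
      (by simpa using sinhSq_pos (hsupp hx) hy hxy)).continuousAt.tendsto
    have h3 := h2.comp (tendsto_const_nhds.add
      (tendsto_nhdsWithin_of_tendsto_nhds (a := (0 : ℝ)) (s := Ioi 0) tendsto_id))
    rw [add_zero] at h3
    exact h3.mul_const _

variable [CompleteSpace F]

/-- The Green potential inverts the hyperbolic Laplacian up to normalization. -/
theorem hypLap_greenPotential (hn : 2 ≤ n) (hψ : ContDiff ℝ ∞ ψ)
    (hcompact : HasCompactSupport ψ) (hsupp : tsupport ψ ⊆ halfSpace n) {y : E n}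
    (hy : y ∈ halfSpace n) :
    hypLap (greenPotential 0 ψ) y = (-(2 ^ (n - 2) * sphereArea n)) • ψ y := by
  have hyn : 0 < y (last n) := hy
  set Θ : E n → F := fun x => (x (last n) ^ (n - 2))⁻¹ • ψ x with hΘ
  have hts : tsupport Θ ⊆ tsupport ψ := closure_mono fun x hx hx0 => hx (by simp [hΘ, hx0])
  have hΘc : Continuous Θ := by
    refine continuous_of_tsupport fun x hx => ?_
    exact (continuousOn_inv_last_pow.continuousAt (isOpen_halfSpace.mem_nhds (hsupp (hts hx)))).smul
      hψ.continuous.continuousAt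
  have h1 := tendsto_integral_approxKernel hn hΘc
    (hcompact.of_isClosed_subset (isClosed_tsupport _) hts) (hts.trans hsupp) hy
  -- The approximate identity is parametrized by `δ = √ε`.
  have hsq : Tendsto (fun δ : ℝ => δ ^ 2) (𝓝[>] 0) (𝓝[>] 0) := by
    refine tendsto_nhdsWithin_iff.2 ⟨?_, ?_⟩
    · have : Tendsto (fun δ : ℝ => δ ^ 2) (𝓝 0) (𝓝 (0 ^ 2)) := tendsto_id.pow 2
      rw [zero_pow two_ne_zero] at this
      exact this.mono_left nhdsWithin_le_nhds
    · filter_upwards [self_mem_nhdsWithin] with δ hδ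
      exact pow_pos (show 0 < δ from hδ) 2
  have h2 := (tendsto_hypLap_greenPotential hn hψ hcompact hsupp hy).comp hsq
  have h3 := tendsto_nhds_unique (h2.congr' ?_) (h1.const_smul (y (last n) ^ 2)⁻¹)
  · rw [h3, hΘ]
    simp only [smul_smul]
    congr 1
    -- The powers `y_n^(-2)`, `y_n^n` and `y_n^(-(n-2))` cancel, and `2^n / 4 = 2^(n-2)`.
    obtain ⟨m, rfl⟩ := Nat.exists_eq_add_of_le' hn
    simp only [Nat.add_sub_cancel]
    field_simp
    ring
  · filter_upwards [self_mem_nhdsWithin] with δ hδ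
    have hδ : 0 < δ := hδ
    exact hypLap_greenPotential_regularized hn hψ hcompact hsupp (by positivity) hy

end GreenPotential

/-! ### Dirac operators -/

section Clifford

variable {n : ℕ}

/-- Left multiplication by `e_j` as a continuous linear map. -/
def mulE (j : Fin n) : Cl n →L[ℝ] Cl n := (LinearMap.mulLeft ℝ (e j)).toContinuousLinearMap

theorem mulE_apply (j : Fin n) (A : Cl n) : mulE j A = e j * A := rfl

/-- Adding the sum to itself with `i` and `j` exchanged makes the off-diagonal terms cancel by
anticommutation. Applied to the symmetric second derivative this is `D² = -△`. -/
theorem sum_e_mul_e_mul {B : Fin n → Fin n → Cl n} (hB : ∀ i j, B i j = B j i) :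
    ∑ i, ∑ j, e i * (e j * B i j) = -∑ i, B i i := by
  have h1 : ∑ i, ∑ j, e i * (e j * B i j) = ∑ i, ∑ j, e j * (e i * B i j) := by
    rw [Finset.sum_comm]
    exact Finset.sum_congr rfl fun i _ => Finset.sum_congr rfl fun j _ => by rw [hB]
  have h2 : ∀ i j : Fin n, e i * (e j * B i j) + e j * (e i * B i j) =
      if j = i then -((2 : ℝ) • B i i) else 0 := by
    intro i j
    split_ifs with h
    · subst h
      rw [← mul_assoc, e_sq, two_smul]
      noncomm_ring
    · rw [← mul_assoc, ← mul_assoc, ← add_mul, e_anticomm h]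
      simp
  have h3 : (2 : ℝ) • ∑ i, ∑ j, e i * (e j * B i j) = (2 : ℝ) • -∑ i, B i i := by
    rw [two_smul]
    nth_rewrite 2 [h1]
    simp only [← Finset.sum_add_distrib, h2, Finset.sum_ite_eq', Finset.mem_univ, if_true, smul_neg, Finset.smul_sum, Finset.sum_neg_distrib]
  exact smul_right_injective _ (two_ne_zero (α := ℝ)) h3

theorem hasFDerivAt_dirac {u : E n → Cl n} {y : E n} (hu : ContDiffAt ℝ 2 u y) :
    HasFDerivAt (dirac u) (∑ j : Fin n, (mulE j).comp
      ((ContinuousLinearMap.apply ℝ (Cl n) (stdVec j)).comp (fderiv ℝ (fderiv ℝ u) y))) y := by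
  have h2 : DifferentiableAt ℝ (fderiv ℝ u) y :=
    (hu.fderiv_right (m := 1) (by norm_num)).differentiableAt (by simp)
  refine HasFDerivAt.fun_sum fun j _ => ?_
  exact (mulE j).hasFDerivAt.comp y
    ((ContinuousLinearMap.apply ℝ (Cl n) (stdVec j)).hasFDerivAt.comp y h2.hasFDerivAt)

theorem dirac_dirac {u : E n → Cl n} {y : E n} (hu : ContDiffAt ℝ 2 u y) :
    dirac (dirac u) y = -∑ j : Fin n, fderiv ℝ (fderiv ℝ u) y (stdVec j) (stdVec j) := by
  have hs : IsSymmSndFDerivAt ℝ u y := hu.isSymmSndFDerivAt (by simp)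
  rw [← sum_e_mul_e_mul (B := fun i j => fderiv ℝ (fderiv ℝ u) y (stdVec i) (stdVec j))
    fun i j => hs _ _, dirac, (hasFDerivAt_dirac hu).fderiv]
  simp [mulE_apply, Finset.mul_sum]

theorem contDiffOn_dirac {u : E n → Cl n} {U : Set (E n)} (hU : IsOpen U)
    (hu : ContDiffOn ℝ 2 u U) : ContDiffOn ℝ 1 (dirac u) U := by
  have h : ContDiffOn ℝ 1 (fderiv ℝ u) U := hu.fderiv_of_isOpen hU (by norm_num)
  refine ContDiffOn.sum fun j _ => ?_
  exact (mulE j).contDiff.comp_contDiffOn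
    ((ContinuousLinearMap.apply ℝ (Cl n) (stdVec j)).contDiff.comp_contDiffOn h)

theorem dirac_congr {f g : E n → Cl n} {y : E n} (h : f =ᶠ[𝓝 y] g) : dirac f y = dirac g y := by
  rw [dirac, dirac, h.fderiv_eq]

theorem dirac_const_smul (c : ℝ) (f : E n → Cl n) (y : E n) :
    dirac (fun z => c • f z) y = c • dirac f y := by
  have h : fderiv ℝ (fun z => c • f z) y = c • fderiv ℝ f y :=
    congrFun (fderiv_const_smul_field (f := f) c) y
  simp [dirac, h, Finset.smul_sum]

/-- No integrability is required: an isometric inclusion commutes with the integral, including its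
default value `0`. -/
theorem setIntegral_mem_submodule {V : Type*} [NormedAddCommGroup V] [NormedSpace ℝ V]
    [FiniteDimensional ℝ V] (S : Submodule ℝ V) {f : E n → V} (hf : ∀ x, f x ∈ S)
    (K : Set (E n)) : ∫ x in K, f x ∈ S := by
  have : CompleteSpace S := FiniteDimensional.complete ℝ S
  have : CompleteSpace V := FiniteDimensional.complete ℝ V
  have h := S.subtypeₗᵢ.integral_comp_comm (μ := volume.restrict K) (fun x => (⟨f x, hf x⟩ : S))
  simp only [Submodule.coe_subtypeₗᵢ, Submodule.subtype_apply] at h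
  rw [h]
  exact Subtype.coe_prop _

variable [NeZero n]

/-- Terms with `j ≠ last n` lie in `Cl_{n-1}` and have no `Q`-part. Writing `e_n b = C e_n`, the
last term gives `-e_n C e_n = -e_n e_n b = b`. -/
theorem Q'_sum_e_mul {b : Fin n → Cl n} (hb : ∀ j, b j ∈ ClSub n) :
    Q' (∑ j, e j * b j) = b (last n) := by
  obtain ⟨C, hC, h⟩ := e_last_mul_mem (hb (last n))
  have hB : ∑ j ∈ Finset.univ.erase (last n), e j * b j ∈ ClSub n :=
    sum_mem fun j hj => mul_mem (Algebra.subset_adjoin ⟨j, (Finset.mem_erase.1 hj).1, rfl⟩) (hb j)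
  rw [← Finset.sum_erase_add _ _ (Finset.mem_univ (last n)), h, Q', (P_Q_unique hB hC).2,
    mul_assoc, ← h, ← mul_assoc, e_sq]
  simp

theorem P_of_mem {A : Cl n} (hA : A ∈ ClSub n) : P A = A := by
  simpa using (P_Q_unique hA (zero_mem (ClSub n))).1

theorem diracHodge_congr {f g : E n → Cl n} {y : E n} (h : f =ᶠ[𝓝 y] g) :
    diracHodge f y = diracHodge g y := by
  rw [diracHodge, diracHodge, dirac_congr h, h.eq_of_nhds]

theorem Q'_smul (c : ℝ) (A : Cl n) : Q' (c • A) = c • Q' A := by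
  have h : Q (c • A) = c • Q A := by
    rw [Q, Q, map_smul, ← smul_sub, smul_mul_assoc, smul_comm]
  rw [Q', Q', h, mul_smul_comm, smul_mul_assoc, smul_neg]

theorem diracHodge_const_smul (c : ℝ) (f : E n → Cl n) (y : E n) :
    diracHodge (fun z => c • f z) y = c • diracHodge f y := by
  rw [diracHodge, diracHodge, dirac_const_smul, Q'_smul, smul_add, smul_comm c]

/-- The Dirac-Hodge operator factors the hyperbolic Laplacian on `Cl_{n-1}`-valued functions. -/
theorem diracHodge_dirac {u : E n → Cl n} {y : E n} (hu : ContDiffAt ℝ 2 u y)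
    (hmem : ∀ j, fderiv ℝ u y (stdVec j) ∈ ClSub n) :
    diracHodge (dirac u) y = -hypLap u y := by
  rw [diracHodge, dirac_dirac hu, hypLap]
  conv_lhs => rw [dirac, Q'_sum_e_mul hmem]
  abel

theorem hypLap_congr {F : Type*} [NormedAddCommGroup F] [NormedSpace ℝ F] {f g : E n → F}
    {y : E n} (h : f =ᶠ[𝓝 y] g) : hypLap f y = hypLap g y := by
  rw [hypLap, hypLap, h.fderiv_eq, h.fderiv.fderiv_eq]

theorem hypLap_const_smul {F : Type*} [NormedAddCommGroup F] [NormedSpace ℝ F] (c : ℝ)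
    (f : E n → F) (y : E n) : hypLap (fun z => c • f z) y = c • hypLap f y := by
  have h : fderiv ℝ (fun z => c • f z) = c • fderiv ℝ f :=
    fderiv_const_smul_field (f := f) c
  have h2 : fderiv ℝ (c • fderiv ℝ f) y = c • fderiv ℝ (fderiv ℝ f) y :=
    congrFun (fderiv_const_smul_field (f := fderiv ℝ f) c) y
  rw [hypLap, hypLap, h, h2]
  simp [smul_sub, Finset.smul_sum, smul_smul, mul_comm]

/-! ### The Cauchy kernel -/

theorem fderiv_algebraMap_green (hn : 2 ≤ n) {x y : E n} (hx : x ∈ halfSpace n)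
    (hy : y ∈ halfSpace n) (hxy : x ≠ y) (v : E n) :
    fderiv ℝ (fun z => algebraMap ℝ (Cl n) (green x z)) y v =
      algebraMap ℝ (Cl n) (greenProfileDeriv n (sinhSq x y) * sinhSqDeriv x y v) := by
  have h1 : (fun z => algebraMap ℝ (Cl n) (green x z)) =ᶠ[𝓝 y]
      fun z => (Algebra.linearMap ℝ (Cl n)).toContinuousLinearMap
        (greenProfile n (sinhSq x z + 0)) := by
    filter_upwards [isOpen_halfSpace.mem_nhds hy] with z hz
    rw [green_eq hx hz, add_zero]
    rfl
  have h2 := hasFDerivAt_greenProfile_sinhSq (ε := 0) hn hx hy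
    (by simpa using sinhSq_pos hx hy hxy)
  have h3 := ((Algebra.linearMap ℝ (Cl n)).toContinuousLinearMap.hasFDerivAt).comp y h2
  rw [h1.fderiv_eq]
  refine (DFunLike.congr_fun h3.fderiv v).trans ?_
  rw [add_zero]
  rfl

theorem cauchyKernel_mul (hn : 2 ≤ n) {x y : E n} (hx : x ∈ halfSpace n)
    (hy : y ∈ halfSpace n) (hxy : x ≠ y) (A : Cl n) :
    cauchyKernel x y * A =
      ∑ j, mulE j ((greenProfileDeriv n (sinhSq x y) * sinhSqDeriv x y (stdVec j)) • A) := by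
  rw [cauchyKernel, dirac, Finset.sum_mul]
  refine Finset.sum_congr rfl fun j _ => ?_
  rw [fderiv_algebraMap_green hn hx hy hxy, mulE_apply, mul_assoc, Algebra.smul_def]

variable {ψ : E n → Cl n}

theorem integrableOn_mulE_greenProfileDeriv (hn : 2 ≤ n) (hψ : ContDiff ℝ ∞ ψ)
    (hcompact : HasCompactSupport ψ) (hsupp : tsupport ψ ⊆ halfSpace n) {y : E n}
    (hy : y ∈ halfSpace n) (j : Fin n) :
    IntegrableOn (fun x => mulE j ((greenProfileDeriv n (sinhSq x y) *
      sinhSqDeriv x y (stdVec j)) • ((x (last n) ^ (n - 2))⁻¹ • ψ x))) (tsupport ψ) :=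
  (mulE j).integrable_comp (integrableOn_smul_continuousOn hcompact
    (integrableOn_greenProfileDeriv hn hcompact hsupp hy _)
    ((continuousOn_inv_last_pow.mono hsupp).smul hψ.continuous.continuousOn))

theorem ae_cauchyKernel_smul (hn : 2 ≤ n) (hcompact : HasCompactSupport ψ)
    (hsupp : tsupport ψ ⊆ halfSpace n) {y : E n} (hy : y ∈ halfSpace n) :
    (fun x => (x (last n) ^ (n - 2))⁻¹ • (cauchyKernel x y * ψ x))
      =ᵐ[volume.restrict (tsupport ψ)] fun x => ∑ j, mulE j ((greenProfileDeriv n (sinhSq x y) *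
        sinhSqDeriv x y (stdVec j)) • ((x (last n) ^ (n - 2))⁻¹ • ψ x)) := by
  filter_upwards [ae_restrict_ne y, ae_restrict_mem hcompact.measurableSet] with x hxy hx
  rw [cauchyKernel_mul hn (hsupp hx) hy hxy, Finset.smul_sum]
  refine Finset.sum_congr rfl fun j _ => ?_
  rw [← map_smul, smul_comm]

theorem integrableOn_cauchyKernel (hn : 2 ≤ n) (hψ : ContDiff ℝ ∞ ψ)
    (hcompact : HasCompactSupport ψ) (hsupp : tsupport ψ ⊆ halfSpace n) {y : E n}
    (hy : y ∈ halfSpace n) :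
    IntegrableOn (fun x => (x (last n) ^ (n - 2))⁻¹ • (cauchyKernel x y * ψ x))
      (halfSpace n) := by
  refine IntegrableOn.of_forall_sdiff_eq_zero (s := tsupport ψ) ?_ isOpen_halfSpace.measurableSet
    fun x hx => by rw [image_eq_zero_of_notMem_tsupport hx.2, mul_zero, smul_zero]
  exact (integrable_finsetSum _ fun j _ =>
    integrableOn_mulE_greenProfileDeriv hn hψ hcompact hsupp hy j).congr
    (ae_cauchyKernel_smul hn hcompact hsupp hy).symm

/-- `D_y` is exchanged with the integral one coordinate at a time. The formula for `h` is used only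
for `x ≠ y`, which is almost everywhere. -/
theorem integral_cauchyKernel (hn : 2 ≤ n) (hψ : ContDiff ℝ ∞ ψ)
    (hcompact : HasCompactSupport ψ) (hsupp : tsupport ψ ⊆ halfSpace n) {y : E n}
    (hy : y ∈ halfSpace n) :
    ∫ x in halfSpace n, (x (last n) ^ (n - 2))⁻¹ • (cauchyKernel x y * ψ x) =
      dirac (greenPotential 0 ψ) y := by
  have : CompleteSpace (Cl n) := FiniteDimensional.complete ℝ (Cl n)
  rw [setIntegral_eq_of_subset_of_forall_sdiff_eq_zero isOpen_halfSpace.measurableSet hsupp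
    fun x hx => by rw [image_eq_zero_of_notMem_tsupport hx.2, mul_zero, smul_zero],
    integral_congr_ae (ae_cauchyKernel_smul hn hcompact hsupp hy),
    integral_finsetSum _ fun j _ => integrableOn_mulE_greenProfileDeriv hn hψ hcompact hsupp hy j, dirac]
  refine Finset.sum_congr rfl fun j _ => ?_
  rw [fderiv_greenPotential hn hψ hcompact hsupp hy, ← mulE_apply]
  exact (mulE j).integral_comp_comm (integrableOn_smul_continuousOn hcompact
    (integrableOn_greenProfileDeriv hn hcompact hsupp hy _)
    ((continuousOn_inv_last_pow.mono hsupp).smul hψ.continuous.continuousOn))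

theorem integrableOn_green (hn : 2 ≤ n) (hψ : ContDiff ℝ ∞ ψ)
    (hcompact : HasCompactSupport ψ) (hsupp : tsupport ψ ⊆ halfSpace n) {y : E n}
    (hy : y ∈ halfSpace n) :
    IntegrableOn (fun x => (x (last n) ^ (n - 2))⁻¹ • (green x y • ψ x)) (halfSpace n) := by
  refine IntegrableOn.of_forall_sdiff_eq_zero (s := tsupport ψ) ?_ isOpen_halfSpace.measurableSet
    fun x hx => by rw [image_eq_zero_of_notMem_tsupport hx.2, smul_zero, smul_zero]
  refine (integrableOn_smul_continuousOn hcompact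
    (integrableOn_greenProfile hn hcompact hsupp hy le_rfl)
    ((continuousOn_inv_last_pow.mono hsupp).smul hψ.continuous.continuousOn)).congr_fun
    (fun x hx => ?_) hcompact.measurableSet
  simp only [add_zero]
  rw [green_eq (hsupp hx) hy, smul_comm]
  rfl

theorem integral_green {y : E n} (hy : y ∈ halfSpace n) :
    ∫ x in halfSpace n, (x (last n) ^ (n - 2))⁻¹ • (green x y • ψ x) = greenPotential 0 ψ y := by
  refine setIntegral_congr_fun isOpen_halfSpace.measurableSet fun x hx => ?_
  simp only [add_zero]
  rw [green_eq hx hy]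

theorem sphereArea_pos : 0 < sphereArea n := by
  have := nontrivial_E (n := n)
  rw [sphereArea, Measure.toSphere_real_apply_univ, finrank_euclideanSpace, Fintype.card_fin]
  have h1 : 0 < (n : ℝ) := Nat.cast_pos.2 (NeZero.pos n)
  have h2 : 0 < volume.real (Metric.ball (0 : E n) 1) :=
    ENNReal.toReal_pos (Metric.measure_ball_pos _ _ one_pos).ne' measure_ball_lt_top.ne
  positivity

end Clifford

end UpperHalfSpace

end

/-! ### The two inversion formulas -/

open UpperHalfSpace in
theorem theorem4 (n : ℕ) [NeZero n] (hn : 2 < n) (ψ : E n → Cl n)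
    (hsmooth : ContDiff ℝ ∞ ψ) (hcompact : HasCompactSupport ψ)
    (hsupp : tsupport ψ ⊆ halfSpace n) (hval : ∀ x, ψ x ∈ ClSub n) :
    -- the potential of the kernel `G` inverts the hyperbolic Laplacian
    ((∀ y ∈ halfSpace n,
        IntegrableOn (fun x => (x (last n) ^ (n - 2))⁻¹ • (green x y • ψ x)) (halfSpace n)) ∧
      ContDiffOn ℝ 2
        (fun y => ∫ x in halfSpace n, (x (last n) ^ (n - 2))⁻¹ • (green x y • ψ x))
        (halfSpace n) ∧
      ∀ y ∈ halfSpace n,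
        hypLaplacian (fun y' => (-(1 / (2 ^ (n - 2) * sphereArea n))) •
          ∫ x in halfSpace n, (x (last n) ^ (n - 2))⁻¹ • (green x y' • ψ x)) y = ψ y) ∧
    -- the potential of the kernel `h = D_y G` inverts `P ∘ M`
    ((∀ y ∈ halfSpace n,
        IntegrableOn (fun x => (x (last n) ^ (n - 2))⁻¹ • (cauchyKernel x y * ψ x))
          (halfSpace n)) ∧
      ContDiffOn ℝ 1
        (fun y => ∫ x in halfSpace n, (x (last n) ^ (n - 2))⁻¹ • (cauchyKernel x y * ψ x))
        (halfSpace n) ∧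
      ∀ y ∈ halfSpace n,
        P (diracHodge (fun y' => (1 / (2 ^ (n - 2) * sphereArea n)) •
          ∫ x in halfSpace n, (x (last n) ^ (n - 2))⁻¹ • (cauchyKernel x y' * ψ x)) y)
            = ψ y) := by
  have : CompleteSpace (Cl n) := FiniteDimensional.complete ℝ (Cl n)
  have hn2 : 2 ≤ n := hn.le
  have hC2 : ContDiffOn ℝ 2 (greenPotential 0 ψ) (halfSpace n) :=
    contDiffOn_greenPotential hn2 hsmooth hcompact hsupp le_rfl
  have hω := sphereArea_pos (n := n)
  refine ⟨⟨fun y hy => integrableOn_green hn2 hsmooth hcompact hsupp hy,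
    hC2.congr fun y hy => integral_green hy, fun y hy => ?_⟩,
    fun y hy => integrableOn_cauchyKernel hn2 hsmooth hcompact hsupp hy,
    (contDiffOn_dirac isOpen_halfSpace hC2).congr fun y hy =>
      integral_cauchyKernel hn2 hsmooth hcompact hsupp hy, fun y hy => ?_⟩
  · have heq := Filter.eventually_of_mem (isOpen_halfSpace.mem_nhds hy) fun z hz =>
      congrArg ((-(1 / (2 ^ (n - 2) * sphereArea n))) • ·) (integral_green (ψ := ψ) hz)
    rw [hypLaplacian_eq, hypLap_congr heq, hypLap_const_smul,
      hypLap_greenPotential hn2 hsmooth hcompact hsupp hy, smul_smul]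
    rw [neg_mul_neg, one_div_mul_cancel (by positivity), one_smul]
  · have heq := Filter.eventually_of_mem (isOpen_halfSpace.mem_nhds hy) fun z hz =>
      congrArg ((1 / (2 ^ (n - 2) * sphereArea n)) • ·)
        (integral_cauchyKernel hn2 hsmooth hcompact hsupp hz)
    -- The derivative is an integral of real multiples of values of `ψ`, so it stays in the subspace
    -- `Cl_{n-1}`.
    have hmem : ∀ j, fderiv ℝ (greenPotential 0 ψ) y (stdVec j) ∈ ClSub n := fun j => by
      rw [fderiv_greenPotential hn2 hsmooth hcompact hsupp hy]
      exact setIntegral_mem_submodule (Subalgebra.toSubmodule (ClSub n))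
        (fun x => Submodule.smul_mem _ _ (Submodule.smul_mem _ _ (hval x))) _
    -- The sign in `M D = -△_{R^{n,+}}` accounts for the opposite signs of the two normalizations.
    -- `M` already returns `ψ`, on which `P` acts as the identity.
    rw [diracHodge_congr heq, diracHodge_const_smul,
      diracHodge_dirac (hC2.contDiffAt (isOpen_halfSpace.mem_nhds hy)) hmem,
      hypLap_greenPotential hn2 hsmooth hcompact hsupp hy, ← neg_smul, neg_neg, smul_smul,
      one_div_mul_cancel (by positivity), one_smul, P_of_mem (hval y)]
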